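/- Let $m\in\mathbb N$ and let all function spaces be complex valued: $L^2=L^2(\mathbb R^m)$, $\ell^2=\ell^2(\mathbb Z^m)$, with $\hat f(\xi)=\int f(x)e^{-2\pi i x\cdot\xi}dx$. **Equation.** Let $\mathbb L$ be a constant-coefficient linear differential operator whose Fourier symbol $l$ (a polynomial) satisfies $l(\xi)\neq0$ for all $\xi\in\mathbb R^m$. Let $H^l=\{u\in L^2: l\hat u\in L^2\}$ with norm $\|u\|_l=\|l\hat u\|_{2}=\|\mathbb Lu\|_{2}$. Let $\mathbb G(u)=\sum_{i=2}^{N}\sum_{k\in J_i}(\mathbb G^1_{i,k}u)\cdots(\mathbb G^i_{i,k}u)$, where each $J_i$ is finite and each $\mathbb G^p_{i,k}$ is a constant-coefficient linear differential operator with symbol $g^p_{i,k}$ such that $g^p_{i,k}/l\in L^1(\mathbb R^m)$. Let $J_{\mathbb G}$ be the finite set of multi-indices $\alpha$ for which $\partial^\alpha$ occurs in some $\mathbb G^p_{i,k}$, and assume that $\xi\mapsto(2\pi i\xi)^\alpha/l(\xi)$ is bounded for every $\alpha\in J_{\mathbb G}$, so that $\partial^\alpha\mathbb L^{-1}$ (the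 Fourier multiplier with this symbol) is a bounded operator on $L^2$. Let $\psi\in L^2$ and $\mathbb F(u)=\mathbb Lu+\mathbb G(u)-\psi$ on $H^l$. **Linearization.** Let $d>0$, $\Omega_0=(-d,d)^m$, and let $u_0\in H^l$ vanish almost everywhere outside $\Omega_0$. Expanding $D\mathbb G(u_0)$ by the product rule gives $D\mathbb G(u_0)=\sum_{\alpha\in J_{\mathbb G}}\mathbb v_\alpha\partial^\alpha$, where, if $\mathbb G^p_{i,k}=\sum_\alpha c^{p,\alpha}_{i,k}\partial^\alpha$, the operator $\mathbb v_\alpha:L^2\to L^2$ is multiplication by $v_\alpha=\sum_{i,k}\sum_{p}c^{p,\alpha}_{i,k}\prod_{q\ne p}\mathbb G^q_{i,k}u_0$. **Periodic problem.** For $n\in\mathbb Z^m$ put $\tilde n=n/(2d)$ and $\psi_n(x)=e^{2\pi i\tilde n\cdot x}$. Let $X^l$ be the space of sequences $U$ with $\|U\|_l:=\|(l(\tilde n)U_n)_n\|_{\ell^2}<\infty$, and $L:X^l\to\ell^2$, $(LU)_n=l(\tilde n)U_n$. Let $U_0$ be the sequence of Fourier coefficients $|\Omega_0|^{-1}\int_{\Omega_0}u_0\,\overline{\psi_n}\,dx$.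 Let $DF(U_0)=L+DG(U_0):X^l\to\ell^2$, where $DG(U_0)H=\sum_{i,k}\sum_p\big(\ast_{q\neq p}\,G^q_{i,k}U_0\big)*(G^p_{i,k}H)$, with discrete convolutions and $(G^p_{i,k}U)_n=g^p_{i,k}(\tilde n)U_n$, is the linearization of the periodic nonlinearity. **Operators.** A bounded operator $\mathbb T$ on $L^2$ with $\mathbb T=\mathbb 1_{\Omega_0}\mathbb T\mathbb 1_{\Omega_0}$ has the Fourier series representation $T=(t_{p,j})_{p,j\in\mathbb Z^m}:\ell^2\to\ell^2$, $t_{p,j}=|\Omega_0|^{-1}\int_{\Omega_0}(\mathbb T\mathbb 1_{\Omega_0}\psi_j)\overline{\psi_p}\,dx$; conversely each bounded $T$ on $\ell^2$ represents exactly one such $\mathbb T$. Let $\mathbb K_\alpha$ be the one represented by the adjoint $(\partial^\alpha L^{-1})^*$ of the diagonal operator on $\ell^2$ with entries $(2\pi i\tilde n)^\alpha/l(\tilde n)$. **Theorem.** Let $\mathbb B_{\Omega_0}$ be a bounded operator on $L^2$ with $\mathbb B_{\Omega_0}=\mathbb 1_{\Omega_0}\mathbb B_{\Omega_0}\mathbb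 1_{\Omega_0}$ and Fourier series representation $B_{\Omega_0}$. Let $\mathbb A:L^2\to H^l$ be a bounded linear operator with $\mathbb A=\mathbb L^{-1}(I_d+\mathbb B_{\Omega_0})$, i.e. $\mathbb L\mathbb A=I_d+\mathbb B_{\Omega_0}$. Put $B=I_d+B_{\Omega_0}$ and $A=L^{-1}B:\ell^2\to X^l$. Let $Z_1,\mathcal Z_u\in\mathbb R$ satisfy $$\|I_d-A\,DF(U_0)\|_{l}\le Z_1,\qquad \max\{1,\|B\|_2\}\sum_{\alpha\in J_{\mathbb G}}\big\|\big(\mathbb K_\alpha-(\partial^\alpha\mathbb L^{-1})^*\big)\mathbb v_\alpha^*\big\|_2\le\mathcal Z_u .$$ Then $\mathbb F:H^l\to L^2$ is Fréchet differentiable at $u_0$ with derivative $D\mathbb F(u_0)=\mathbb L+\sum_{\alpha\in J_{\mathbb G}}\mathbb v_\alpha\partial^\alpha$, and $$\|I_d-\mathbb A\,D\mathbb F(u_0)\|_l\le \mathcal Z_1:=Z_1+\mathcal Z_u .$$ Moreover, if $\mathcal Z_1<1$, then both $\mathbb A:L^2\to H^l$ and $D\mathbb F(u_0):H^l\to L^2$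 have bounded inverses, and $$\|D\mathbb F(u_0)^{-1}\|_{2,l}\le\frac{\max\{1,\|B\|_2\}}{1-\mathcal Z_1}.$$ -/

import Mathlib

open MeasureTheory FourierTransform
open scoped ENNReal

noncomputable section

namespace SemilinearPDE

/-! ### Function and sequence spaces -/

/-- Complex-valued `L²(ℝᵐ)`. -/
abbrev L2 (m : ℕ) : Type := Lp (α := EuclideanSpace ℝ (Fin m)) ℂ 2 volume

/-- `ℓ²(ℤᵐ)`, complex-valued. -/
abbrev Ell2 (m : ℕ) : Type := lp (fun _ : Fin m → ℤ => ℂ) 2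

/-- The open cube `Ω₀ = (-d, d)ᵐ`. -/
def cube (m : ℕ) (d : ℝ) : Set (EuclideanSpace ℝ (Fin m)) :=
  {x | ∀ j, x j ∈ Set.Ioo (-d) d}

/-- The frequency `ñ = n / (2d)`. -/
def freq {m : ℕ} (d : ℝ) (n : Fin m → ℤ) : EuclideanSpace ℝ (Fin m) :=
  WithLp.toLp 2 fun j => (n j : ℝ) / (2 * d)

/-- The exponential `ψₙ(x) = exp(2πi ñ·x)`. -/
def expMode {m : ℕ} (d : ℝ) (n : Fin m → ℤ) (x : EuclideanSpace ℝ (Fin m)) : ℂ :=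
  Complex.exp (2 * Real.pi * Complex.I * (∑ j, freq d n j * x j : ℝ))

/-- The `n`-th Fourier coefficient on `Ω₀`:
`uₙ = |Ω₀|⁻¹ ∫_{Ω₀} u(x) exp(-2πi ñ·x) dx`. -/
def fourierCoeffs {m : ℕ} (d : ℝ) (u : EuclideanSpace ℝ (Fin m) → ℂ) (n : Fin m → ℤ) : ℂ :=
  (((2 * d) ^ m : ℝ) : ℂ)⁻¹ * ∫ x in cube m d, u x * (starRingEnd ℂ) (expMode d n x)

/-! ### Operators on `L²(ℝᵐ)` and on `ℓ²(ℤᵐ)` -/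

/-- Multiplication by `v` on `L²`, for `v ∈ L^∞` (and `0` otherwise). -/
def mulOp {m : ℕ} (v : EuclideanSpace ℝ (Fin m) → ℂ) : L2 m →L[ℂ] L2 m :=
  open Classical in
  if h : MemLp v ∞ volume then
    (ContinuousLinearMap.mul ℂ ℂ).holderL volume ∞ 2 2 (h.toLp v)
  else 0

/-- Multiplication by the indicator function of `Ω₀`. -/
def cutoff (m : ℕ) (d : ℝ) : L2 m →L[ℂ] L2 m :=
  mulOp ((cube m d).indicator fun _ => 1)

/-- The Fourier multiplier `f ↦ 𝓕⁻¹(σ 𝓕f)` on `L²`, for a symbol `σ ∈ L^∞`. -/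
def fourierMult {m : ℕ} (σ : EuclideanSpace ℝ (Fin m) → ℂ) : L2 m →L[ℂ] L2 m :=
  ((Lp.fourierTransformₗᵢ (EuclideanSpace ℝ (Fin m)) ℂ).symm.toContinuousLinearEquiv :
      L2 m →L[ℂ] L2 m) ∘L mulOp σ ∘L
    ((Lp.fourierTransformₗᵢ (EuclideanSpace ℝ (Fin m)) ℂ).toContinuousLinearEquiv :
      L2 m →L[ℂ] L2 m)

/-- The diagonal operator `(Vₙ) ↦ (σₙ Vₙ)` on `ℓ²`, for a bounded sequence `σ`
(and `0` otherwise). -/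
def diagOp {m : ℕ} (σ : (Fin m → ℤ) → ℂ) : Ell2 m →L[ℂ] Ell2 m :=
  open Classical in
  if h : ∃ K : ℝ, 0 ≤ K ∧ ∀ n, ‖ContinuousLinearMap.mul ℂ ℂ (σ n)‖ ≤ K then
    lp.mapCLM 2 (fun n => ContinuousLinearMap.mul ℂ ℂ (σ n)) h.choose_spec.1 h.choose_spec.2
  else 0

/-- The discrete convolution operator `V ↦ U * V`, `(U * V)ₙ = ∑ₖ Uₖ Vₙ₋ₖ`, whenever this is a
bounded operator on `ℓ²` (in particular for `U ∈ ℓ¹`). -/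
def convOp {m : ℕ} (U : (Fin m → ℤ) → ℂ) : Ell2 m →L[ℂ] Ell2 m :=
  open Classical in
  if h : ∃ T : Ell2 m →L[ℂ] Ell2 m, ∀ (V : Ell2 m) (n : Fin m → ℤ),
      HasSum (fun k => U k * V (n - k)) (T V n) then h.choose else 0

/-! ### Fourier series on the cube and the correspondence of operators -/

theorem measurableSet_cube (m : ℕ) (d : ℝ) : MeasurableSet (cube m d) := by
  have : cube m d = ⋂ j, (fun x : EuclideanSpace ℝ (Fin m) => x j) ⁻¹' Set.Ioo (-d) d := by
    ext x; simp [cube]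
  rw [this]
  exact MeasurableSet.iInter fun j => (by fun_prop : Measurable fun
    x : EuclideanSpace ℝ (Fin m) => x j) measurableSet_Ioo

theorem integral_exp_interval {d : ℝ} (hd : 0 < d) (k : ℤ) :
    ∫ t in Set.Ioo (-d) d, Complex.exp (2 * Real.pi * Complex.I * ((k : ℝ) / (2 * d) * t : ℝ)) =
      if k = 0 then ((2 * d : ℝ) : ℂ) else 0 := by
  rw [← integral_Ioc_eq_integral_Ioo, ← intervalIntegral.integral_of_le (by linarith)]
  split_ifs with hk
  · subst hk
    simp
    ring
  · have hd' : (d : ℂ) ≠ 0 := by exact_mod_cast hd.ne'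
    have hk' : (k : ℂ) ≠ 0 := by exact_mod_cast hk
    have hpi : (Real.pi : ℂ) ≠ 0 := by exact_mod_cast Real.pi_ne_zero
    have hc : 2 * (Real.pi : ℂ) * Complex.I * (k / (2 * d)) ≠ 0 := by
      simp [hd', hk', hpi]
    have : ∀ t : ℝ, Complex.exp (2 * Real.pi * Complex.I * ((k : ℝ) / (2 * d) * t : ℝ)) =
        Complex.exp (2 * (Real.pi : ℂ) * Complex.I * (k / (2 * d)) * t) := by
      intro t; congr 1; push_cast; ring
    simp_rw [this]
    rw [integral_exp_mul_complex hc]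
    have h1 : 2 * (Real.pi : ℂ) * Complex.I * (k / (2 * d)) * (d : ℝ) =
        2 * (Real.pi : ℂ) * Complex.I * (k / (2 * d)) * ((-d : ℝ) : ℂ) +
          k * (2 * Real.pi * Complex.I) := by
      push_cast; field_simp; ring
    rw [h1, Complex.exp_periodic.int_mul k]
    simp

theorem continuous_expMode {m : ℕ} (d : ℝ) (n : Fin m → ℤ) : Continuous (expMode d n) := by
  unfold expMode; fun_prop

theorem norm_expMode {m : ℕ} (d : ℝ) (n : Fin m → ℤ) (x : EuclideanSpace ℝ (Fin m)) :
    ‖expMode d n x‖ = 1 := by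
  unfold expMode
  rw [show (2 * Real.pi * Complex.I * (∑ j, freq d n j * x j : ℝ) : ℂ) =
    ((2 * Real.pi * ∑ j, freq d n j * x j : ℝ) : ℂ) * Complex.I by push_cast; ring]
  exact Complex.norm_exp_ofReal_mul_I _

theorem conj_expMode_mul {m : ℕ} (d : ℝ) (n k : Fin m → ℤ) (x : EuclideanSpace ℝ (Fin m)) :
    (starRingEnd ℂ) (expMode d n x) * expMode d k x =
      ∏ j, Complex.exp (2 * Real.pi * Complex.I *
        (((k j - n j : ℤ) : ℝ) / (2 * d) * x j : ℝ)) := by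
  unfold expMode freq
  rw [← Complex.exp_conj, ← Complex.exp_add, ← Complex.exp_sum]
  congr 1
  simp only [map_mul, Complex.conj_I, Complex.conj_ofReal, map_ofNat]
  push_cast
  rw [Finset.mul_sum, Finset.mul_sum, ← Finset.sum_add_distrib]
  refine Finset.sum_congr rfl fun j _ => ?_
  ring

theorem setIntegral_conj_expMode_mul {m : ℕ} {d : ℝ} (hd : 0 < d) (n k : Fin m → ℤ) :
    ∫ x in cube m d, (starRingEnd ℂ) (expMode d n x) * expMode d k x =
      if n = k then (((2 * d) ^ m : ℝ) : ℂ) else 0 := by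
  simp_rw [conj_expMode_mul]
  have hpre : cube m d = (WithLp.ofLp : EuclideanSpace ℝ (Fin m) → (Fin m → ℝ)) ⁻¹'
      (Set.univ.pi fun _ => Set.Ioo (-d) d) := by
    ext x; simp [cube]
  rw [hpre, (PiLp.volume_preserving_ofLp (Fin m)).setIntegral_preimage_emb
    (MeasurableEquiv.toLp 2 (Fin m → ℝ)).symm.measurableEmbedding
    (fun y : Fin m → ℝ => ∏ j, Complex.exp (2 * Real.pi * Complex.I *
        (((k j - n j : ℤ) : ℝ) / (2 * d) * y j : ℝ))),
    volume_pi, Measure.restrict_pi_pi,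
    integral_fintype_prod_eq_prod (fun j (t : ℝ) => Complex.exp (2 * Real.pi * Complex.I *
        (((k j - n j : ℤ) : ℝ) / (2 * d) * t : ℝ)))]
  simp_rw [integral_exp_interval hd]
  split_ifs with h
  · subst h; simp
  · obtain ⟨j, hj⟩ := Function.ne_iff.1 h
    exact Finset.prod_eq_zero (Finset.mem_univ j) (if_neg (by omega))

theorem volume_cube_lt_top (m : ℕ) (d : ℝ) : volume (cube m d) < ∞ := by
  have hpre : cube m d = (WithLp.ofLp : EuclideanSpace ℝ (Fin m) → (Fin m → ℝ)) ⁻¹'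
      (Set.univ.pi fun _ => Set.Ioo (-d) d) := by
    ext x; simp [cube]
  rw [hpre, (PiLp.volume_preserving_ofLp (Fin m)).measure_preimage
    (MeasurableSet.univ_pi fun _ => measurableSet_Ioo).nullMeasurableSet, volume_pi_pi]
  simp only [Real.volume_Ioo]
  exact ENNReal.prod_lt_top fun _ _ => ENNReal.ofReal_lt_top

/-- `|Ω₀|^{-1/2} 𝟙_{Ω₀} ψₙ`, as a function on `ℝᵐ`. -/
def modeFun {m : ℕ} (d : ℝ) (n : Fin m → ℤ) : EuclideanSpace ℝ (Fin m) → ℂ :=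
  (cube m d).indicator fun x => ((Real.sqrt ((2 * d) ^ m) : ℝ) : ℂ)⁻¹ * expMode d n x

theorem memLp_modeFun {m : ℕ} (d : ℝ) (n : Fin m → ℤ) : MemLp (modeFun d n) 2 volume := by
  rw [modeFun, memLp_indicator_iff_restrict (measurableSet_cube m d)]
  have : IsFiniteMeasure (volume.restrict (cube m d)) :=
    ⟨by simpa using volume_cube_lt_top m d⟩
  refine MemLp.of_bound (C := ‖((Real.sqrt ((2 * d) ^ m) : ℝ) : ℂ)⁻¹‖)
    ((continuous_const.mul (continuous_expMode d n)).aestronglyMeasurable)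
    (Filter.Eventually.of_forall fun x => ?_)
  rw [norm_mul, norm_expMode, mul_one]

/-- `|Ω₀|^{-1/2} 𝟙_{Ω₀} ψₙ`, as an element of `L²(ℝᵐ)`. -/
def mode {m : ℕ} (d : ℝ) (n : Fin m → ℤ) : L2 m := (memLp_modeFun d n).toLp

theorem orthonormal_mode {m : ℕ} {d : ℝ} (hd : 0 < d) :
    Orthonormal ℂ (mode d : (Fin m → ℤ) → L2 m) := by
  classical
  rw [orthonormal_iff_ite]
  intro n k
  have hc : (((2 * d) ^ m : ℝ) : ℂ) ≠ 0 := by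
    exact_mod_cast (pow_pos (by linarith : (0 : ℝ) < 2 * d) m).ne'
  have hs : ((Real.sqrt ((2 * d) ^ m) : ℝ) : ℂ) * ((Real.sqrt ((2 * d) ^ m) : ℝ) : ℂ) =
      (((2 * d) ^ m : ℝ) : ℂ) := by
    rw [← Complex.ofReal_mul, Real.mul_self_sqrt (by positivity)]
  have hae : (fun x => inner ℂ ((mode d n : L2 m) x) ((mode d k : L2 m) x)) =ᵐ[volume]
      (cube m d).indicator fun x => (((2 * d) ^ m : ℝ) : ℂ)⁻¹ *
        ((starRingEnd ℂ) (expMode d n x) * expMode d k x) := by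
    filter_upwards [(memLp_modeFun d n).coeFn_toLp, (memLp_modeFun d k).coeFn_toLp] with x h1 h2
    rw [mode, mode, h1, h2]
    by_cases hx : x ∈ cube m d
    · simp only [modeFun, Set.indicator_of_mem hx, RCLike.inner_apply, map_mul, map_inv₀,
        Complex.conj_ofReal]
      rw [← hs, mul_inv]; ring
    · simp [modeFun, Set.indicator_of_notMem hx]
  rw [L2.inner_def, integral_congr_ae hae, integral_indicator (measurableSet_cube m d),
    integral_const_mul, setIntegral_conj_expMode_mul hd]
  split_ifs
  · exact inv_mul_cancel₀ hc
  · simp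

/-- The isometry `ℓ² → L²`, `U ↦ |Ω₀|^{-1/2} 𝟙_{Ω₀} ∑ₙ Uₙ ψₙ`. -/
def synth {m : ℕ} {d : ℝ} (hd : 0 < d) : Ell2 m →L[ℂ] L2 m :=
  ((orthonormal_mode (m := m) hd).orthogonalFamily.linearIsometry).toContinuousLinearMap

/-- The Fourier series representation of an operator on `L²`: the operator on `ℓ²` with matrix
`b_{p,j} = |Ω₀|⁻¹ ∫_{Ω₀} (T 𝟙_{Ω₀} ψⱼ)(x) (ψₚ(x))^* dx` (see `fourierRep_single`). -/
def fourierRep {m : ℕ} {d : ℝ} (hd : 0 < d) (T : L2 m →L[ℂ] L2 m) : Ell2 m →L[ℂ] Ell2 m :=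
  (synth hd).adjoint ∘L T ∘L synth hd

/-- `𝓕⁻¹(B)`: the operator on `L²`, supported on `Ω₀`, whose Fourier series representation
is `B`. -/
def ofFourierRep {m : ℕ} {d : ℝ} (hd : 0 < d) (B : Ell2 m →L[ℂ] Ell2 m) : L2 m →L[ℂ] L2 m :=
  synth hd ∘L B ∘L (synth hd).adjoint

theorem memLp_expMode {m : ℕ} (d : ℝ) (n : Fin m → ℤ) :
    MemLp ((cube m d).indicator (expMode d n)) 2 volume := by
  rw [memLp_indicator_iff_restrict (measurableSet_cube m d)]
  have : IsFiniteMeasure (volume.restrict (cube m d)) :=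
    ⟨by simpa using volume_cube_lt_top m d⟩
  exact MemLp.of_bound (C := 1) (continuous_expMode d n).aestronglyMeasurable
    (Filter.Eventually.of_forall fun x => (norm_expMode d n x).le)

theorem mode_eq_smul {m : ℕ} (d : ℝ) (n : Fin m → ℤ) :
    (mode d n : L2 m) = ((Real.sqrt ((2 * d) ^ m) : ℝ) : ℂ)⁻¹ • (memLp_expMode d n).toLp := by
  rw [mode, ← MemLp.toLp_const_smul]
  refine MemLp.toLp_congr _ _ (Filter.Eventually.of_forall fun x => ?_)
  by_cases hx : x ∈ cube m d <;> simp [modeFun, hx]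

theorem fourierRep_single {m : ℕ} {d : ℝ} (hd : 0 < d) (T : L2 m →L[ℂ] L2 m)
    (p j : Fin m → ℤ) :
    fourierRep hd T (lp.single 2 j 1) p =
      (((2 * d) ^ m : ℝ) : ℂ)⁻¹ * ∫ x in cube m d,
        T ((memLp_expMode d j).toLp) x * (starRingEnd ℂ) (expMode d p x) := by
  have hsingle : ∀ n : Fin m → ℤ, synth hd (lp.single 2 n (1 : ℂ)) = mode d n := by
    intro n
    simp [synth]
  have hs : ((Real.sqrt ((2 * d) ^ m) : ℝ) : ℂ) * ((Real.sqrt ((2 * d) ^ m) : ℝ) : ℂ) =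
      (((2 * d) ^ m : ℝ) : ℂ) := by
    rw [← Complex.ofReal_mul, Real.mul_self_sqrt (by positivity)]
  have h1 : fourierRep hd T (lp.single 2 j 1) p =
      inner ℂ (mode d p : L2 m) (T (mode d j)) := by
    rw [← hsingle p, ← hsingle j, ← ContinuousLinearMap.adjoint_inner_right]
    rw [lp.inner_single_left]
    simp [fourierRep]
  rw [h1, mode_eq_smul d j, mode_eq_smul d p, map_smul, inner_smul_left, inner_smul_right,
    ← mul_assoc, map_inv₀, Complex.conj_ofReal, ← mul_inv, hs, L2.inner_def,
    ← integral_indicator (measurableSet_cube m d)]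
  congr 1
  refine integral_congr_ae ?_
  filter_upwards [(memLp_expMode d p).coeFn_toLp] with x hx
  rw [hx]
  by_cases hx' : x ∈ cube m d <;> simp [hx', RCLike.inner_apply]

/-! ### The equation -/

/-- The Fourier symbol `ξ ↦ Q(2πi ξ)` of the constant-coefficient linear differential operator
`Q(∂₁, …, ∂ₘ)`. -/
def symbol {m : ℕ} (Q : MvPolynomial (Fin m) ℂ) (ξ : EuclideanSpace ℝ (Fin m)) : ℂ :=
  MvPolynomial.eval (fun j => 2 * Real.pi * Complex.I * (ξ j : ℂ)) Q

/-- The equation `𝕃u + 𝔾(u) = ψ` on `ℝᵐ`, with `𝔾 = ∑_{i=2}^N 𝔾ᵢ` and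
`𝔾ᵢ(u) = ∑_{k ∈ Jᵢ} (𝔾¹ᵢₖ u) ⋯ (𝔾ⁱᵢₖ u)`. Linear constant-coefficient differential operators are
given as polynomials in the partial derivatives. -/
structure Equation (m : ℕ) where
  /-- the linear part `𝕃` -/
  lin : MvPolynomial (Fin m) ℂ
  /-- the symbol `l` of `𝕃` does not vanish on `ℝᵐ` -/
  symbol_lin_ne_zero : ∀ ξ, symbol lin ξ ≠ 0
  /-- the degree of `𝔾` -/
  N : ℕ
  /-- the index set of the monomials of degree `i` -/
  J : ℕ → Finset ℕ
  /-- the factor `𝔾ᵖᵢₖ` -/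
  factor : (i k : ℕ) → Fin i → MvPolynomial (Fin m) ℂ
  /-- the semilinearity assumption `gᵖᵢₖ / l ∈ L¹` -/
  integrable_symbol : ∀ i ∈ Finset.Icc 2 N, ∀ k ∈ J i, ∀ p : Fin i,
    Integrable fun ξ => symbol (factor i k p) ξ / symbol lin ξ
  /-- the right-hand side -/
  psi : L2 m

/-- `Q(∂)u = 𝓕⁻¹(Q(2πi·) 𝓕u)` for `u ∈ L²` with `Q(2πi·) 𝓕u ∈ L²` (and `0` otherwise). -/
def diffOp {m : ℕ} (Q : MvPolynomial (Fin m) ℂ) (u : L2 m) : L2 m :=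
  open Classical in
  if h : MemLp (fun ξ => symbol Q ξ * (𝓕 u : L2 m) ξ) 2 volume then 𝓕⁻ (h.toLp : L2 m) else 0

/-- The product of finitely many functions, as an element of `L²` (and `0` if it is not in `L²`). -/
def prodL2 {m : ℕ} {ι : Type} [Fintype ι] (f : ι → L2 m) : L2 m :=
  open Classical in
  if h : MemLp (fun x => ∏ p, f p x) 2 volume then h.toLp else 0

namespace Equation

variable {m : ℕ} (P : Equation m)

/-- The subspace `{u ∈ L² : l û ∈ L²}`. -/
def hlSubmodule : Submodule ℂ (L2 m) where
  carrier := {u | MemLp (fun ξ => symbol P.lin ξ * (𝓕 u : L2 m) ξ) 2 volume}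
  add_mem' {u v} hu hv := by
    refine (MemLp.add hu hv).ae_eq ?_
    rw [FourierTransform.fourier_add]
    filter_upwards [Lp.coeFn_add (𝓕 u : L2 m) (𝓕 v : L2 m)] with ξ h
    rw [h, Pi.add_apply, Pi.add_apply, mul_add]
  zero_mem' := by
    have h0 : (𝓕 (0 : L2 m) : L2 m) = 0 :=
      (Lp.fourierTransformₗᵢ (EuclideanSpace ℝ (Fin m)) ℂ).map_zero
    refine (MemLp.zero (ε := ℂ)).ae_eq ?_
    rw [h0]
    filter_upwards [Lp.coeFn_zero ℂ 2 (volume : Measure (EuclideanSpace ℝ (Fin m)))] with ξ h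
    rw [h, Pi.zero_apply, mul_zero]
  smul_mem' c u hu := by
    refine (MemLp.const_smul hu c).ae_eq ?_
    rw [FourierTransform.fourier_smul]
    filter_upwards [Lp.coeFn_smul c (𝓕 u : L2 m)] with ξ h
    simp [h]; ring

/-- The space `H^l`. It carries the norm `‖u‖_l = ‖l û‖₂`, not the norm of `L²`. -/
def Hl : Type := P.hlSubmodule

instance : AddCommGroup P.Hl := inferInstanceAs (AddCommGroup P.hlSubmodule)

instance : Module ℂ P.Hl := inferInstanceAs (Module ℂ P.hlSubmodule)

/-- The inclusion `H^l → L²`. -/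
def toL2 : P.Hl →ₗ[ℂ] L2 m := P.hlSubmodule.subtype

theorem memLp_symbol_mul (u : P.Hl) :
    MemLp (fun ξ => symbol P.lin ξ * (𝓕 (P.toL2 u) : L2 m) ξ) 2 volume := u.2

/-- The map `u ↦ l û` from `H^l` to `L²`. -/
def weight : P.Hl →ₗ[ℂ] L2 m where
  toFun u := (P.memLp_symbol_mul u).toLp
  map_add' u v := by
    rw [← MemLp.toLp_add]
    refine MemLp.toLp_congr _ _ ?_
    rw [map_add, FourierTransform.fourier_add]
    filter_upwards [Lp.coeFn_add (𝓕 (P.toL2 u) : L2 m) (𝓕 (P.toL2 v) : L2 m)] with ξ h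
    rw [h, Pi.add_apply, Pi.add_apply, mul_add]
  map_smul' c u := by
    rw [RingHom.id_apply, ← MemLp.toLp_const_smul]
    refine MemLp.toLp_congr _ _ ?_
    rw [map_smul, FourierTransform.fourier_smul]
    filter_upwards [Lp.coeFn_smul c (𝓕 (P.toL2 u) : L2 m)] with ξ h
    simp [h]; ring

theorem weight_injective : Function.Injective P.weight := by
  rw [injective_iff_map_eq_zero]
  intro u hu
  have h1 : (𝓕 (P.toL2 u) : L2 m) = 0 := by
    rw [Lp.eq_zero_iff_ae_eq_zero]
    have h2 := (P.memLp_symbol_mul u).coeFn_toLp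
    have h3 := (Lp.eq_zero_iff_ae_eq_zero (f := P.weight u)).1 hu
    filter_upwards [h2, h3] with ξ h2 h3
    have : symbol P.lin ξ * (𝓕 (P.toL2 u) : L2 m) ξ = 0 := h2.symm.trans h3
    exact (mul_eq_zero.1 this).resolve_left (P.symbol_lin_ne_zero ξ)
  have h4 : P.toL2 u = 0 :=
    (Lp.fourierTransformₗᵢ (EuclideanSpace ℝ (Fin m)) ℂ).map_eq_zero_iff.1 h1
  exact Subtype.ext h4

instance : NormedAddCommGroup P.Hl :=
  NormedAddCommGroup.induced P.Hl (L2 m) P.weight P.weight_injective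

instance : NormedSpace ℂ P.Hl := NormedSpace.induced ℂ P.Hl (L2 m) P.weight

/-- The isometry `𝕃 : H^l → L²`, `𝕃u = 𝓕⁻¹(l û)`. -/
def opL : P.Hl →L[ℂ] L2 m :=
  ((Lp.fourierTransformₗᵢ (EuclideanSpace ℝ (Fin m)) ℂ).symm.toContinuousLinearEquiv :
      L2 m →L[ℂ] L2 m) ∘L
    (LinearIsometry.mk P.weight fun _ => rfl : P.Hl →ₗᵢ[ℂ] L2 m).toContinuousLinearMap

/-- `𝔾(u) = ∑_{i=2}^N ∑_{k ∈ Jᵢ} ∏ₚ 𝔾ᵖᵢₖ u`. -/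
def opG (u : P.Hl) : L2 m :=
  ∑ i ∈ Finset.Icc 2 P.N, ∑ k ∈ P.J i,
    prodL2 fun p : Fin i => diffOp (P.factor i k p) (P.toL2 u)

/-- `𝔽(u) = 𝕃u + 𝔾(u) - ψ`. -/
def opF (u : P.Hl) : L2 m := P.opL u + P.opG u - P.psi

/-- The set `J_𝔾` of multi-indices `α` such that `∂^α` occurs in a factor of `𝔾`. -/
def JG : Finset (Fin m →₀ ℕ) :=
  (Finset.Icc 2 P.N).biUnion fun i => (P.J i).biUnion fun k =>
    Finset.univ.biUnion fun p : Fin i => (P.factor i k p).support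

/-- The symbol `(2πi ξ)^α / l(ξ)` of `∂^α 𝕃⁻¹`. -/
def symbolDL (α : Fin m →₀ ℕ) (ξ : EuclideanSpace ℝ (Fin m)) : ℂ :=
  symbol (MvPolynomial.monomial α 1) ξ / symbol P.lin ξ

/-- The operator `∂^α 𝕃⁻¹ : L² → L²`, for bounded `(2πi ξ)^α / l(ξ)`. -/
def opDL (α : Fin m →₀ ℕ) : L2 m →L[ℂ] L2 m := fourierMult (P.symbolDL α)

/-- The coefficient `v_α` of `∂^α` in the linearization `D𝔾(u₀) = ∑_α v_α ∂^α`: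
if `𝔾ᵖᵢₖ = ∑_α c_α ∂^α`, the product rule gives
`v_α = ∑_{i,k} ∑ₚ c_α ∏_{q ≠ p} 𝔾^qᵢₖ u₀`. -/
def coeffV (u₀ : P.Hl) (α : Fin m →₀ ℕ) (x : EuclideanSpace ℝ (Fin m)) : ℂ :=
  ∑ i ∈ Finset.Icc 2 P.N, ∑ k ∈ P.J i, ∑ p : Fin i,
    (P.factor i k p).coeff α *
      ∏ q ∈ Finset.univ.erase p, diffOp (P.factor i k q) (P.toL2 u₀) x

/-- `D𝔾(u₀) = ∑_{α ∈ J_𝔾} v_α ∂^α : H^l → L²`, where `∂^α = (∂^α 𝕃⁻¹) 𝕃`. -/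
def opDG (u₀ : P.Hl) : P.Hl →L[ℂ] L2 m :=
  ∑ α ∈ P.JG, mulOp (P.coeffV u₀ α) ∘L P.opDL α ∘L P.opL

/-- `D𝔽(u₀) = 𝕃 + D𝔾(u₀) : H^l → L²`. -/
def opDF (u₀ : P.Hl) : P.Hl →L[ℂ] L2 m := P.opL + P.opDG u₀

/-! ### The periodic problem on `Ω₀`, in Fourier coefficients -/

/-- The sequences `U` with `(l(ñ) Uₙ) ∈ ℓ²`. -/
def xlSubmodule (d : ℝ) : Submodule ℂ ((Fin m → ℤ) → ℂ) where
  carrier := {U | Memℓp (fun n => symbol P.lin (freq d n) * U n) 2}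
  add_mem' {U V} hU hV := by
    have h := Memℓp.add hU hV
    have e : (fun n => symbol P.lin (freq d n) * (U + V) n) =
        (fun n => symbol P.lin (freq d n) * U n) + fun n => symbol P.lin (freq d n) * V n := by
      ext n; simp [mul_add]
    change Memℓp (fun n => symbol P.lin (freq d n) * (U + V) n) 2
    rw [e]; exact h
  zero_mem' := by
    have h : Memℓp (0 : (Fin m → ℤ) → ℂ) 2 := zero_memℓp
    have e : (fun n => symbol P.lin (freq d n) * (0 : (Fin m → ℤ) → ℂ) n) = 0 := by
      ext n; simp
    change Memℓp (fun n => symbol P.lin (freq d n) * (0 : (Fin m → ℤ) → ℂ) n) 2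
    rw [e]; exact h
  smul_mem' c U hU := by
    have h := Memℓp.const_smul hU c
    have e : (fun n => symbol P.lin (freq d n) * (c • U) n) =
        c • fun n => symbol P.lin (freq d n) * U n := by
      ext n; simp; ring
    change Memℓp (fun n => symbol P.lin (freq d n) * (c • U) n) 2
    rw [e]; exact h

/-- The space `X^l`, with the norm `‖U‖_l = ‖(l(ñ) Uₙ)ₙ‖₂`. -/
def Xl (d : ℝ) : Type := P.xlSubmodule d

instance (d : ℝ) : AddCommGroup (P.Xl d) := inferInstanceAs (AddCommGroup (P.xlSubmodule d))

instance (d : ℝ) : Module ℂ (P.Xl d) := inferInstanceAs (Module ℂ (P.xlSubmodule d))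

/-- The sequence underlying an element of `X^l`. -/
def toSeq {d : ℝ} (U : P.Xl d) : (Fin m → ℤ) → ℂ := U.1

/-- The bijection `L : X^l → ℓ²`, `(LU)ₙ = l(ñ) Uₙ`. -/
def perLₗ (d : ℝ) : P.Xl d ≃ₗ[ℂ] Ell2 m where
  toFun U := ⟨fun n => symbol P.lin (freq d n) * P.toSeq U n, U.2⟩
  map_add' U V := by
    ext n; exact mul_add _ _ _
  map_smul' c U := by
    ext n; exact mul_left_comm _ _ _
  invFun V := ⟨fun n => V n / symbol P.lin (freq d n), by
    have e : (fun n => symbol P.lin (freq d n) * (V n / symbol P.lin (freq d n))) = V := by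
      ext n; exact mul_div_cancel₀ _ (P.symbol_lin_ne_zero _)
    change Memℓp (fun n => symbol P.lin (freq d n) * (V n / symbol P.lin (freq d n))) 2
    rw [e]; exact V.2⟩
  left_inv U := by
    refine Subtype.ext (funext fun n => ?_)
    exact mul_div_cancel_left₀ _ (P.symbol_lin_ne_zero _)
  right_inv V := by
    ext n; exact mul_div_cancel₀ _ (P.symbol_lin_ne_zero _)

instance (d : ℝ) : NormedAddCommGroup (P.Xl d) :=
  NormedAddCommGroup.induced (P.Xl d) (Ell2 m) (P.perLₗ d).toLinearMap (P.perLₗ d).injective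

instance (d : ℝ) : NormedSpace ℂ (P.Xl d) :=
  NormedSpace.induced ℂ (P.Xl d) (Ell2 m) (P.perLₗ d).toLinearMap

/-- The isometric isomorphism `L : X^l → ℓ²`, `(LU)ₙ = l(ñ) Uₙ`. -/
def perL (d : ℝ) : P.Xl d ≃ₗᵢ[ℂ] Ell2 m := ⟨P.perLₗ d, fun _ => rfl⟩

/-- The operator `X^l → ℓ²`, `(Uₙ) ↦ (Q(2πi ñ) Uₙ)`, for bounded `Q(2πi ñ) / l(ñ)`. -/
def perDiff (d : ℝ) (Q : MvPolynomial (Fin m) ℂ) : P.Xl d →L[ℂ] Ell2 m :=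
  diagOp (fun n => symbol Q (freq d n) / symbol P.lin (freq d n)) ∘L
    ((P.perL d).toContinuousLinearEquiv : P.Xl d →L[ℂ] Ell2 m)

/-- The linearization at the sequence `U₀` of the periodic nonlinearity
`G(U) = ∑_{i,k} (𝔾¹ᵢₖ U) * ⋯ * (𝔾ⁱᵢₖ U)` (products are discrete convolutions):
`DG(U₀)H = ∑_{i,k} ∑ₚ (∗_{q ≠ p} 𝔾^qᵢₖ U₀) * (𝔾ᵖᵢₖ H)`. -/
def perDG (d : ℝ) (U₀ : (Fin m → ℤ) → ℂ) : P.Xl d →L[ℂ] Ell2 m :=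
  ∑ i ∈ Finset.Icc 2 P.N, ∑ k ∈ P.J i, ∑ p : Fin i,
    (((List.finRange i).erase p).map fun q =>
      convOp fun n => symbol (P.factor i k q) (freq d n) * U₀ n).prod ∘L
        P.perDiff d (P.factor i k p)

/-- `DF(U₀) = L + DG(U₀) : X^l → ℓ²`. -/
def perDF (d : ℝ) (U₀ : (Fin m → ℤ) → ℂ) : P.Xl d →L[ℂ] Ell2 m :=
  ((P.perL d).toContinuousLinearEquiv : P.Xl d →L[ℂ] Ell2 m) + P.perDG d U₀

/-- `A = L⁻¹B : ℓ² → X^l`. -/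
def perA (d : ℝ) (B : Ell2 m →L[ℂ] Ell2 m) : Ell2 m →L[ℂ] P.Xl d :=
  ((P.perL d).symm.toContinuousLinearEquiv : Ell2 m →L[ℂ] P.Xl d) ∘L B

/-- `𝕂_α = 𝓕⁻¹((∂^α L⁻¹)^*)`: the operator on `L²`, supported on `Ω₀`, whose Fourier series
representation is the adjoint of the diagonal operator `∂^α L⁻¹` on `ℓ²`. -/
def opK {d : ℝ} (hd : 0 < d) (α : Fin m →₀ ℕ) : L2 m →L[ℂ] L2 m :=
  ofFourierRep hd (diagOp fun n => P.symbolDL α (freq d n)).adjoint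

end Equation

end SemilinearPDE

end

noncomputable section

namespace SemilinearPDE

/-! ### Multiplication operators and Fourier multipliers -/

section Mult

variable {m : ℕ}

/-! The map `𝕃 : H^l → L²` is isometric, so the estimate can be made on `L²`. There `D𝔽(u₀) = (1 +
M)𝕃` with `M = ∑ v_α ∂^α𝕃⁻¹` (`opM`) and `𝕃𝔸 = 1 + 𝔹`, and the quantity to bound becomes `‖1 - (1 +
𝔹)(1 + M)‖₂`.

Replace `M` by `M_Ω = ∑ v_α 𝕂_α^*` (`opMΩ`). All `v_α` vanish off `Ω₀`, so `1 - (1 + 𝔹)(1 + M_Ω)`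
lives on `L²(Ω₀)`, where the Fourier modes are an orthonormal basis; its matrix there is `1 - B(1 +
DG(U₀)L⁻¹)`, of norm at most `Z₁` (`perDG_eq`, `norm_one_sub_comp_le`). This identification uses
that differential operators do not enlarge supports, that the Fourier coefficients of `Q(∂)u₀` are
`Q(2πi ñ)` times those of `u₀`, and that multiplication becomes convolution. What remains is `(1 +
𝔹)(M_Ω - M)`. Since `1 + 𝔹` is the identity off `Ω₀` and `B` on `Ω₀`, its norm is at most `max{1,
‖B‖}`, and `𝒵_u` bounds the remainder (`norm_one_sub_comp_opM_le`).

For differentiability, each `g/l` is integrable and bounded, hence in `L²`, so each factor of `𝔾`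
maps `H^l` boundedly into `L² ∩ L^∞`. Each monomial is then a bounded multilinear map on the
diagonal (`hasFDerivAt_prodL2`).

A bound `‖1 - (1 + 𝔹)(1 + M)‖ < 1` alone gives only one-sided inverses. Two facts complete it. `M`
is compact, being a sum of Hilbert–Schmidt operators, so the Fredholm alternative makes `1 + M`, and
then `1 + 𝔹`, invertible (`isUnit_of_norm_one_sub_mul_lt_one`). And `𝕃` is onto (`opL_surjective`):
this is not automatic, because `l` may approach `0` at infinity, but `𝕃𝔸 = 1 + 𝔹` solves `𝕃u = f`
for `f` vanishing on `Ω₀`, and translation invariance carries this to every `f`. -/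

theorem coeFn_mulOp {v : EuclideanSpace ℝ (Fin m) → ℂ} (hv : MemLp v ∞ volume) (f : L2 m) :
    mulOp v f =ᵐ[volume] fun x => v x * f x := by
  rw [mulOp, dif_pos hv]
  filter_upwards [ContinuousLinearMap.coeFn_holder (r := 2) (ContinuousLinearMap.mul ℂ ℂ) (hv.toLp v) f,
    hv.coeFn_toLp] with x h1 h2
  rw [← h2]
  exact h1

theorem mulOp_mul {v w : EuclideanSpace ℝ (Fin m) → ℂ} (hv : MemLp v ∞ volume)
    (hw : MemLp w ∞ volume) : mulOp (fun x => v x * w x) = mulOp v ∘L mulOp w := by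
  ext1 f
  have hvw : MemLp (fun x => v x * w x) ∞ volume := hw.mul hv
  refine Lp.ext ?_
  filter_upwards [coeFn_mulOp hvw f, coeFn_mulOp hv (mulOp w f), coeFn_mulOp hw f] with x h1 h2 h3
  rw [h1, ContinuousLinearMap.comp_apply, h2, h3, mul_assoc]

theorem mulOp_const_mul (c : ℂ) {v : EuclideanSpace ℝ (Fin m) → ℂ} (hv : MemLp v ∞ volume) :
    mulOp (fun x => c * v x) = c • mulOp v := by
  ext1 f
  have hcv : MemLp (fun x => c * v x) ∞ volume := hv.const_mul c
  refine Lp.ext ?_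
  filter_upwards [coeFn_mulOp hcv f, coeFn_mulOp hv f, Lp.coeFn_smul c (mulOp v f)] with x h1 h2 h3
  rw [h1, smul_apply, h3, Pi.smul_apply, h2, smul_eq_mul, mul_assoc]

theorem Lp_finsetSum_coeFn {ι : Type*} (s : Finset ι) (f : ι → L2 m) :
    ((∑ i ∈ s, f i : L2 m) : EuclideanSpace ℝ (Fin m) → ℂ) =ᵐ[volume] fun x => ∑ i ∈ s, f i x := by
  classical
  induction s using Finset.induction_on with
  | empty =>
    exact Filter.Eventually.of_forall fun x => by simp
  | insert a s ha ih =>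
    rw [Finset.sum_insert ha]
    filter_upwards [Lp.coeFn_add (f a) (∑ i ∈ s, f i), ih] with x h1 h2
    rw [h1, Pi.add_apply, h2, Finset.sum_insert ha]

theorem mulOp_finsetSum {ι : Type*} (s : Finset ι) (v : ι → EuclideanSpace ℝ (Fin m) → ℂ)
    (hv : ∀ i ∈ s, MemLp (v i) ∞ volume) :
    mulOp (fun x => ∑ i ∈ s, v i x) = ∑ i ∈ s, mulOp (v i) := by
  ext1 f
  have hs : MemLp (fun x => ∑ i ∈ s, v i x) ∞ volume := memLp_finsetSum s hv
  refine Lp.ext ?_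
  have hall : ∀ᵐ x ∂volume, ∀ i ∈ s, mulOp (v i) f x = v i x * f x := by
    rw [Filter.eventually_all_finset]
    exact fun i hi => coeFn_mulOp (hv i hi) f
  rw [sum_apply]
  filter_upwards [coeFn_mulOp hs f, Lp_finsetSum_coeFn s fun i => mulOp (v i) f, hall]
    with x h1 h2 h3
  rw [h1, h2, Finset.sum_congr rfl h3, Finset.sum_mul]

theorem fourierMult_apply (σ : EuclideanSpace ℝ (Fin m) → ℂ) (f : L2 m) :
    fourierMult σ f = 𝓕⁻ (mulOp σ (𝓕 f : L2 m)) := rfl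

theorem memLp_top_indicator_cube (d : ℝ) :
    MemLp ((cube m d).indicator fun _ => (1 : ℂ)) ∞ volume := by
  refine memLp_top_of_bound ((measurable_const.indicator (measurableSet_cube m d))
    |>.aestronglyMeasurable) 1 (Filter.Eventually.of_forall fun x => ?_)
  by_cases hx : x ∈ cube m d <;> simp [hx]

theorem coeFn_cutoff (d : ℝ) (f : L2 m) :
    cutoff m d f =ᵐ[volume] (cube m d).indicator f := by
  filter_upwards [coeFn_mulOp (memLp_top_indicator_cube d) f] with x h
  rw [cutoff, h]
  by_cases hx : x ∈ cube m d <;> simp [hx]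

end Mult

/-! ### The Fourier transform on `L²` -/

section Fourier

variable {m : ℕ}

open scoped SchwartzMap

theorem integral_schwartz_mul_fourierInv (f : L2 m) (φ : 𝓢(EuclideanSpace ℝ (Fin m), ℂ)) :
    ∫ x, φ x * (𝓕⁻ f : L2 m) x = ∫ x, (𝓕⁻ φ) x * f x := by
  have h := congrArg (fun T : 𝓢'(EuclideanSpace ℝ (Fin m), ℂ) => T φ)
    (Lp.fourierInv_toTemperedDistribution_eq f)
  simpa [TemperedDistribution.fourierInv_apply] using h.symm

theorem integral_schwartz_mul_fourier (f : L2 m) (φ : 𝓢(EuclideanSpace ℝ (Fin m), ℂ)) :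
    ∫ x, φ x * (𝓕 f : L2 m) x = ∫ x, (𝓕 φ) x * f x := by
  have h := congrArg (fun T : 𝓢'(EuclideanSpace ℝ (Fin m), ℂ) => T φ)
    (Lp.fourier_toTemperedDistribution_eq f)
  simpa [TemperedDistribution.fourier_apply] using h.symm

/-- On `L¹ ∩ L²` the `L²`-Fourier transform is given by the Fourier integral. -/
theorem fourier_toLp_ae_eq {f : EuclideanSpace ℝ (Fin m) → ℂ} (hf : MemLp f 2 volume)
    (hf1 : Integrable f) : (𝓕 (hf.toLp f : L2 m) : L2 m) =ᵐ[volume] (𝓕 f) := by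
  have hc : Continuous (𝓕 f) :=
    VectorFourier.fourierIntegral_continuous Real.continuous_fourierChar continuous_inner hf1
  -- Both sides are tested against smooth compactly supported `g`; the transform moves onto `g` on
  -- either side, by duality for tempered distributions and by Fubini for integrals.
  refine ae_eq_of_integral_contDiff_smul_eq ?_ hc.locallyIntegrable fun g hg hgs => ?_
  · exact (Lp.memLp _).locallyIntegrable (by norm_num)
  let φ : 𝓢(EuclideanSpace ℝ (Fin m), ℂ) := HasCompactSupport.toSchwartzMap
    (f := fun x => (g x : ℂ)) (hgs.comp_left (g := fun r : ℝ => (r : ℂ)) Complex.ofReal_zero)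
    (Complex.ofRealCLM.contDiff.comp hg)
  have hφ : ∀ x, φ x = (g x : ℂ) := fun x => rfl
  have h1 := integral_schwartz_mul_fourier (hf.toLp f) φ
  have h2 : ∫ ξ, 𝓕 f ξ * φ ξ = ∫ x, f x * 𝓕 (φ : EuclideanSpace ℝ (Fin m) → ℂ) x := by
    simpa using! VectorFourier.integral_bilin_fourierIntegral_eq_flip (.mul ℂ ℂ)
      (L := innerₗ (EuclideanSpace ℝ (Fin m)))
      Real.continuous_fourierChar continuous_inner hf1 φ.integrable
  simp only [Complex.real_smul, ← hφ]
  rw [h1]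
  simp only [mul_comm (φ _)]
  rw [h2]
  refine integral_congr_ae ?_
  filter_upwards [hf.coeFn_toLp] with x hx
  rw [hx, mul_comm, SchwartzMap.fourier_coe]

/-- On `L¹ ∩ L²` the inverse `L²`-Fourier transform is given by the Fourier integral. -/
theorem fourierInv_toLp_ae_eq {f : EuclideanSpace ℝ (Fin m) → ℂ} (hf : MemLp f 2 volume)
    (hf1 : Integrable f) : (𝓕⁻ (hf.toLp f : L2 m) : L2 m) =ᵐ[volume] (𝓕⁻ f) := by
  have hc : Continuous (𝓕⁻ f) := by
    rw [show 𝓕⁻ f = fun x => 𝓕 f (-x) from funext fun x => Real.fourierInv_eq_fourier_neg f x]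
    exact (VectorFourier.fourierIntegral_continuous Real.continuous_fourierChar
      continuous_inner hf1).comp continuous_neg
  refine ae_eq_of_integral_contDiff_smul_eq ?_ hc.locallyIntegrable fun g hg hgs => ?_
  · exact (Lp.memLp _).locallyIntegrable (by norm_num)
  let φ : 𝓢(EuclideanSpace ℝ (Fin m), ℂ) := HasCompactSupport.toSchwartzMap
    (f := fun x => (g x : ℂ)) (hgs.comp_left (g := fun r : ℝ => (r : ℂ)) Complex.ofReal_zero)
    (Complex.ofRealCLM.contDiff.comp hg)
  have hφ : ∀ x, φ x = (g x : ℂ) := fun x => rfl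
  have h1 := integral_schwartz_mul_fourierInv (hf.toLp f) φ
  have h2 : ∫ ξ, 𝓕 f ξ * φ (-ξ) = ∫ x, f x * 𝓕⁻ (φ : EuclideanSpace ℝ (Fin m) → ℂ) x := by
    have h3 := VectorFourier.integral_bilin_fourierIntegral_eq_flip (.mul ℂ ℂ)
      (L := innerₗ (EuclideanSpace ℝ (Fin m)))
      Real.continuous_fourierChar continuous_inner hf1 (φ.integrable (μ := volume)).comp_neg
    simp only [Real.fourierInv_eq_fourier_comp_neg]
    simpa using! h3
  simp only [Complex.real_smul, ← hφ]
  -- The reflection `ξ ↦ -ξ` reduces the inverse transform to the forward duality formula.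
  have h4 := integral_neg_eq_self (fun ξ => 𝓕 f ξ * φ (-ξ)) volume
  simp only [neg_neg] at h4
  rw [h1]
  simp only [Real.fourierInv_eq_fourier_neg f, mul_comm (φ _)]
  rw [h4, h2]
  refine integral_congr_ae ?_
  filter_upwards [hf.coeFn_toLp] with x hx
  rw [hx, mul_comm, SchwartzMap.fourierInv_coe]

end Fourier

/-! ### Fourier multipliers with square integrable symbols -/

section Kernel

variable {m : ℕ}

theorem memLp_two_of_integrable_of_bound {σ : EuclideanSpace ℝ (Fin m) → ℂ}
    (h1 : Integrable σ) {C : ℝ} (hC : ∀ ξ, ‖σ ξ‖ ≤ C) : MemLp σ 2 volume := by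
  rw [memLp_two_iff_integrable_sq_norm h1.1]
  refine (h1.norm.const_mul C).mono' (h1.1.norm.pow 2) (Filter.Eventually.of_forall fun ξ => ?_)
  rw [Real.norm_of_nonneg (by positivity), sq]
  exact mul_le_mul_of_nonneg_right (hC ξ) (norm_nonneg _)

/-- A Fourier multiplier with a symbol in `L² ∩ L^∞` is an integral operator
`f ↦ (x ↦ ⟪K x, f⟫)`, with a bounded map `K` into `L²`. -/
theorem exists_kernel_fourierMult {σ : EuclideanSpace ℝ (Fin m) → ℂ} (h2 : MemLp σ 2 volume)
    (hi : MemLp σ ∞ volume) :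
    ∃ (K : EuclideanSpace ℝ (Fin m) → L2 m) (C : ℝ), (∀ x, ‖K x‖ ≤ C) ∧
      ∀ f : L2 m, fourierMult σ f =ᵐ[volume] fun x => inner ℂ (K x) f := by
  have hk : ∀ x : EuclideanSpace ℝ (Fin m), MemLp (fun ξ => (starRingEnd ℂ)
      ((Real.fourierChar (inner ℝ ξ x) : ℂ) * σ ξ)) 2 volume := by
    intro x
    refine h2.of_le ?_ (Filter.Eventually.of_forall fun ξ => by
      rw [RCLike.norm_conj, norm_mul, Circle.norm_coe, one_mul])
    refine Complex.continuous_conj.comp_aestronglyMeasurable (AEStronglyMeasurable.mul ?_ h2.1)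
    exact (Continuous.aestronglyMeasurable (by fun_prop))
  -- By Plancherel `⟪K x, f⟫ = ∫ e^{2πi x·ξ} σ f̂ dξ`, the inversion integral, which converges
  -- absolutely by Cauchy–Schwarz; the phase does not affect the norm, so `‖K x‖ ≤ ‖σ‖₂` for all
  -- `x`.
  refine ⟨fun x => 𝓕⁻ ((hk x).toLp : L2 m), ‖h2.toLp‖, fun x => ?_, fun f => ?_⟩
  · have : ‖(𝓕⁻ ((hk x).toLp : L2 m) : L2 m)‖ = ‖((hk x).toLp : L2 m)‖ :=
      (Lp.fourierTransformₗᵢ (EuclideanSpace ℝ (Fin m)) ℂ).symm.norm_map _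
    rw [this]
    refine Lp.norm_le_norm_of_ae_le ?_
    filter_upwards [(hk x).coeFn_toLp, h2.coeFn_toLp] with ξ e1 e2
    rw [e1, e2, RCLike.norm_conj, norm_mul, Circle.norm_coe, one_mul]
  · have hp : MemLp (fun ξ => σ ξ * (𝓕 f : L2 m) ξ) 2 volume := (Lp.memLp (𝓕 f : L2 m)).mul hi
    have hp1 : Integrable (fun ξ => σ ξ * (𝓕 f : L2 m) ξ) :=
      h2.integrable_mul (Lp.memLp (𝓕 f : L2 m))
    have e1 : mulOp σ (𝓕 f : L2 m) = hp.toLp := by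
      refine Lp.ext ?_
      filter_upwards [coeFn_mulOp hi (𝓕 f : L2 m), hp.coeFn_toLp] with ξ a b
      rw [a, b]
    rw [fourierMult_apply, e1]
    refine (fourierInv_toLp_ae_eq hp hp1).trans (Filter.Eventually.of_forall fun x => ?_)
    have e2 : inner ℂ (𝓕⁻ ((hk x).toLp : L2 m) : L2 m) f =
        inner ℂ ((hk x).toLp : L2 m) (𝓕 f : L2 m) := by
      rw [← Lp.inner_fourier_eq, FourierTransform.fourier_fourierInv_eq]
    simp only [e2]
    rw [Real.fourierInv_eq, L2.inner_def]
    refine integral_congr_ae ?_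
    filter_upwards [(hk x).coeFn_toLp] with ξ a
    rw [a, RCLike.inner_apply, Complex.conj_conj, Circle.smul_def, smul_eq_mul]
    ring

/-- Cauchy–Schwarz against the kernel. The resulting `L² → L^∞` bound is what allows products of the
factors of `𝔾` to stay in `L²`. -/
theorem exists_essBound_fourierMult {σ : EuclideanSpace ℝ (Fin m) → ℂ} (h2 : MemLp σ 2 volume)
    (hi : MemLp σ ∞ volume) :
    ∃ C : ℝ, ∀ f : L2 m, ∀ᵐ x, ‖fourierMult σ f x‖ ≤ C * ‖f‖ := by
  obtain ⟨K, C, hC, hK⟩ := exists_kernel_fourierMult h2 hi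
  refine ⟨C, fun f => ?_⟩
  filter_upwards [hK f] with x hx
  rw [hx]
  exact (norm_inner_le_norm _ _).trans (mul_le_mul_of_nonneg_right (hC x) (norm_nonneg _))

end Kernel

/-! ### Products of essentially bounded operators -/

section Prod

variable {m : ℕ} {ι : Type} [Fintype ι]

theorem coeFn_prodL2 {f : ι → L2 m} (h : MemLp (fun x => ∏ p, f p x) 2 volume) :
    prodL2 f =ᵐ[volume] fun x => ∏ p, f p x := by
  rw [prodL2, dif_pos h]
  exact h.coeFn_toLp

theorem memLp_top_prod (s : Finset ι) (f : ι → L2 m) {b : ι → ℝ}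
    (hb : ∀ p, ∀ᵐ x, ‖f p x‖ ≤ b p) : MemLp (fun x => ∏ p ∈ s, f p x) ∞ volume := by
  refine memLp_top_of_bound ?_ (∏ p ∈ s, b p) ?_
  · exact Finset.aestronglyMeasurable_fun_prod s fun p _ => (Lp.aestronglyMeasurable (f p))
  · filter_upwards [ae_all_iff.2 hb] with x hx
    rw [norm_prod]
    exact Finset.prod_le_prod (fun _ _ => norm_nonneg _) fun p _ => hx p

variable [DecidableEq ι]

theorem memLp_two_prod {s : Finset ι} {p₀ : ι} (hp₀ : p₀ ∈ s) (f : ι → L2 m) {b : ι → ℝ}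
    (hb : ∀ p, ∀ᵐ x, ‖f p x‖ ≤ b p) : MemLp (fun x => ∏ p ∈ s, f p x) 2 volume := by
  have h : MemLp (fun x => (∏ p ∈ s.erase p₀, f p x) * f p₀ x) 2 volume :=
    (Lp.memLp (f p₀)).mul (memLp_top_prod (s.erase p₀) f hb)
  simpa only [Finset.prod_erase_mul _ _ hp₀] using h

/-- Hölder with the factor `p₀` in `L²` and all others in `L^∞`. -/
theorem norm_prodL2_le (p₀ : ι) (f : ι → L2 m) {b : ι → ℝ}
    (hb : ∀ p, ∀ᵐ x, ‖f p x‖ ≤ b p) :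
    ‖prodL2 f‖ ≤ (∏ p ∈ Finset.univ.erase p₀, b p) * ‖f p₀‖ := by
  refine Lp.norm_le_mul_norm_of_ae_le_mul ?_
  filter_upwards [coeFn_prodL2 (memLp_two_prod (Finset.mem_univ p₀) f hb), ae_all_iff.2 hb]
    with x hx h
  rw [hx, ← Finset.prod_erase_mul _ _ (Finset.mem_univ p₀), norm_mul, norm_prod]
  exact mul_le_mul_of_nonneg_right
    (Finset.prod_le_prod (fun _ _ => norm_nonneg _) fun p _ => h p) (norm_nonneg _)

variable {H : Type*} [NormedAddCommGroup H] [NormedSpace ℂ H]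

/-- The multilinear map `(u_p)_p ↦ ∏ₚ Tₚ uₚ`, for `Tₚ : H → L² ∩ L^∞`. -/
theorem exists_continuousMultilinearMap_prodL2 [Nonempty ι] (T : ι → H →L[ℂ] L2 m)
    (hT : ∀ p, ∃ C : ℝ, ∀ u, ∀ᵐ x, ‖T p u x‖ ≤ C * ‖u‖) :
    ∃ Φ : ContinuousMultilinearMap ℂ (fun _ : ι => H) (L2 m),
      ∀ u, Φ u = prodL2 fun p => T p (u p) := by
  choose C hC using hT
  obtain ⟨p₀⟩ := ‹Nonempty ι›
  have hco : ∀ u : ι → H, (prodL2 fun p => T p (u p)) =ᵐ[volume] fun x => ∏ p, T p (u p) x :=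
    fun u => coeFn_prodL2 (memLp_two_prod (Finset.mem_univ p₀) _ fun p => hC p (u p))
  have hupd : ∀ (u : ι → H) (p : ι) (w : H) (x : EuclideanSpace ℝ (Fin m)),
      ∏ q, T q (Function.update u p w q) x =
        T p w x * ∏ q ∈ Finset.univ.erase p, T q (u q) x := by
    intro u p w x
    rw [← Finset.mul_prod_erase _ _ (Finset.mem_univ p), Function.update_self]
    congr 1
    refine Finset.prod_congr rfl fun q hq => ?_
    rw [Function.update_of_ne (Finset.ne_of_mem_erase hq)]
  let f : MultilinearMap ℂ (fun _ : ι => H) (L2 m) :=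
    MultilinearMap.mk' (fun u => prodL2 fun p => T p (u p))
      (by
        intro u p y z
        refine Lp.ext ?_
        filter_upwards [hco (Function.update u p (y + z)), hco (Function.update u p y),
          hco (Function.update u p z),
          Lp.coeFn_add (prodL2 fun q => T q (Function.update u p y q))
            (prodL2 fun q => T q (Function.update u p z q)),
          Lp.coeFn_add (T p y) (T p z)] with x h1 h2 h3 h4 h5
        rw [h1, h4, Pi.add_apply, h2, h3, hupd, hupd, hupd, map_add, h5, Pi.add_apply, add_mul])
      (by
        intro u p c y
        refine Lp.ext ?_
        filter_upwards [hco (Function.update u p (c • y)), hco (Function.update u p y),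
          Lp.coeFn_smul c (prodL2 fun q => T q (Function.update u p y q)),
          Lp.coeFn_smul c (T p y)] with x h1 h2 h4 h5
        rw [h1, h4, Pi.smul_apply, h2, hupd, hupd, map_smul, h5, Pi.smul_apply, smul_eq_mul,
          smul_eq_mul, mul_assoc])
  refine ⟨f.mkContinuous ((∏ p ∈ Finset.univ.erase p₀, C p) * ‖T p₀‖) fun u => ?_, fun u => rfl⟩
  -- The constants `C p` come without a sign. Each `C p * ‖u p‖` is nevertheless nonnegative, since
  -- it bounds a norm at some point.
  by_cases h0 : 0 ≤ ∏ p ∈ Finset.univ.erase p₀, C p * ‖u p‖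
  · calc ‖f u‖ ≤ (∏ p ∈ Finset.univ.erase p₀, C p * ‖u p‖) * ‖T p₀ (u p₀)‖ :=
          norm_prodL2_le p₀ _ fun p => hC p (u p)
      _ ≤ (∏ p ∈ Finset.univ.erase p₀, C p * ‖u p‖) * (‖T p₀‖ * ‖u p₀‖) :=
          mul_le_mul_of_nonneg_left ((T p₀).le_opNorm _) h0
      _ = _ := by
          rw [Finset.prod_mul_distrib,
            ← Finset.prod_erase_mul Finset.univ (fun i => ‖u i‖) (Finset.mem_univ p₀)]
          ring
  · exfalso
    refine h0 (Finset.prod_nonneg fun p _ => ?_)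
    obtain ⟨x, hx⟩ := (hC p (u p)).exists
    exact (norm_nonneg _).trans hx

/-- The product rule. -/
theorem hasFDerivAt_prodL2 [Nonempty ι] (T : ι → H →L[ℂ] L2 m)
    (hT : ∀ p, ∃ C : ℝ, ∀ u, ∀ᵐ x, ‖T p u x‖ ≤ C * ‖u‖) (u₀ : H) :
    HasFDerivAt (fun u => prodL2 fun p => T p u)
      (∑ p, mulOp (fun x => ∏ q ∈ Finset.univ.erase p, T q u₀ x) ∘L T p) u₀ := by
  obtain ⟨Φ, hΦ⟩ := exists_continuousMultilinearMap_prodL2 T hT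
  choose C hC using hT
  -- The product is the multilinear map composed with the diagonal embedding.
  have h1 := (Φ.hasFDerivAt fun _ => u₀).comp u₀
    (ContinuousLinearMap.pi fun _ : ι => ContinuousLinearMap.id ℂ H).hasFDerivAt
  have h2 : (fun u => prodL2 fun p => T p u) =
      Φ ∘ (ContinuousLinearMap.pi fun _ : ι => ContinuousLinearMap.id ℂ H) := by
    funext u
    simp [hΦ]
  rw [h2]
  refine h1.congr_fderiv ?_
  ext1 h
  rw [sum_apply, ContinuousLinearMap.comp_apply, ContinuousMultilinearMap.linearDeriv_apply]
  refine Finset.sum_congr rfl fun p _ => ?_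
  rw [hΦ]
  refine Lp.ext ?_
  filter_upwards [coeFn_prodL2 (memLp_two_prod (Finset.mem_univ p)
      (fun q => T q (Function.update (fun _ => u₀) p h q)) fun q => hC q _),
    coeFn_mulOp (memLp_top_prod (Finset.univ.erase p) (fun q => T q u₀) fun q => hC q u₀) (T p h)]
    with x e1 e2
  rw [ContinuousLinearMap.comp_apply, e2]
  refine e1.trans ?_
  rw [← Finset.prod_erase_mul _ _ (Finset.mem_univ p), Function.update_self]
  congr 1
  refine Finset.prod_congr rfl fun q hq => ?_
  rw [Function.update_of_ne (Finset.ne_of_mem_erase hq)]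

end Prod

/-! ### Symbols and differential operators on `H^l` -/

section Symbol

variable {m : ℕ}

theorem continuous_symbol (Q : MvPolynomial (Fin m) ℂ) : Continuous (symbol Q) := by
  unfold symbol
  exact (MvPolynomial.continuous_eval Q).comp (by fun_prop)

theorem symbol_eq_sum (Q : MvPolynomial (Fin m) ℂ) {s : Finset (Fin m →₀ ℕ)} (hs : Q.support ⊆ s)
    (ξ : EuclideanSpace ℝ (Fin m)) :
    symbol Q ξ = ∑ α ∈ s, Q.coeff α * symbol (MvPolynomial.monomial α 1) ξ := by
  have h : symbol Q ξ = ∑ α ∈ Q.support, Q.coeff α * symbol (MvPolynomial.monomial α 1) ξ := by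
    conv_lhs => rw [symbol, Q.as_sum]
    rw [map_sum]
    refine Finset.sum_congr rfl fun α _ => ?_
    rw [symbol, MvPolynomial.eval_monomial, MvPolynomial.eval_monomial, one_mul]
  rw [h]
  refine Finset.sum_subset hs fun α _ hα => ?_
  rw [MvPolynomial.notMem_support_iff.1 hα, zero_mul]

end Symbol

namespace Equation

variable {m : ℕ} (P : Equation m)

/-- The symbol `g / l` of `𝔾 𝕃⁻¹`, where `g` is the symbol of the differential operator `𝔾`. -/
def ratio (Q : MvPolynomial (Fin m) ℂ) (ξ : EuclideanSpace ℝ (Fin m)) : ℂ :=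
  symbol Q ξ / symbol P.lin ξ

theorem continuous_ratio (Q : MvPolynomial (Fin m) ℂ) : Continuous (P.ratio Q) :=
  (continuous_symbol Q).div (continuous_symbol P.lin) P.symbol_lin_ne_zero

theorem memLp_top_ratio {Q : MvPolynomial (Fin m) ℂ} (hQ : ∃ C : ℝ, ∀ ξ, ‖P.ratio Q ξ‖ ≤ C) :
    MemLp (P.ratio Q) ∞ volume := by
  obtain ⟨C, hC⟩ := hQ
  exact memLp_top_of_bound (P.continuous_ratio Q).aestronglyMeasurable C
    (Filter.Eventually.of_forall hC)

theorem ratio_eq_sum {Q : MvPolynomial (Fin m) ℂ} (hQ : Q.support ⊆ P.JG)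
    (ξ : EuclideanSpace ℝ (Fin m)) :
    P.ratio Q ξ = ∑ α ∈ P.JG, Q.coeff α * P.symbolDL α ξ := by
  rw [ratio, symbol_eq_sum Q hQ, Finset.sum_div]
  exact Finset.sum_congr rfl fun α _ => mul_div_assoc _ _ _

theorem support_factor_subset {i : ℕ} (hi : i ∈ Finset.Icc 2 P.N) {k : ℕ} (hk : k ∈ P.J i)
    (p : Fin i) : (P.factor i k p).support ⊆ P.JG := by
  intro α hα
  exact Finset.mem_biUnion.2 ⟨i, hi, Finset.mem_biUnion.2 ⟨k, hk,
    Finset.mem_biUnion.2 ⟨p, Finset.mem_univ p, hα⟩⟩⟩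

section Bounded

variable {P} (hbdd : ∀ α ∈ P.JG, ∃ C : ℝ, ∀ ξ, ‖P.symbolDL α ξ‖ ≤ C)
include hbdd

theorem exists_bound_ratio {Q : MvPolynomial (Fin m) ℂ} (hQ : Q.support ⊆ P.JG) :
    ∃ C : ℝ, ∀ ξ, ‖P.ratio Q ξ‖ ≤ C := by
  choose! C hC using hbdd
  refine ⟨∑ α ∈ P.JG, ‖Q.coeff α‖ * C α, fun ξ => ?_⟩
  rw [P.ratio_eq_sum hQ]
  refine (norm_sum_le _ _).trans (Finset.sum_le_sum fun α hα => ?_)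
  rw [norm_mul]
  exact mul_le_mul_of_nonneg_left (hC α hα ξ) (norm_nonneg _)

theorem memLp_top_symbolDL {α : Fin m →₀ ℕ} (hα : α ∈ P.JG) :
    MemLp (P.symbolDL α) ∞ volume :=
  P.memLp_top_ratio (hbdd α hα)

theorem fourierMult_ratio {Q : MvPolynomial (Fin m) ℂ} (hQ : Q.support ⊆ P.JG) :
    fourierMult (P.ratio Q) = ∑ α ∈ P.JG, Q.coeff α • P.opDL α := by
  have h : mulOp (P.ratio Q) = ∑ α ∈ P.JG, Q.coeff α • mulOp (P.symbolDL α) := by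
    rw [show P.ratio Q = fun ξ => ∑ α ∈ P.JG, Q.coeff α * P.symbolDL α ξ from
      funext (P.ratio_eq_sum hQ), mulOp_finsetSum P.JG (fun α ξ => Q.coeff α * P.symbolDL α ξ)
        fun α hα => (memLp_top_symbolDL hbdd hα).const_mul _]
    exact Finset.sum_congr rfl fun α hα => mulOp_const_mul _ (memLp_top_symbolDL hbdd hα)
  ext1 f
  rw [fourierMult_apply, h]
  change (Lp.fourierTransformₗᵢ (EuclideanSpace ℝ (Fin m)) ℂ).symm _ = _
  simp only [sum_apply, smul_apply, map_sum, map_smul, opDL]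
  rfl

theorem memLp_two_ratio_factor {i : ℕ} (hi : i ∈ Finset.Icc 2 P.N) {k : ℕ} (hk : k ∈ P.J i)
    (p : Fin i) : MemLp (P.ratio (P.factor i k p)) 2 volume := by
  obtain ⟨C, hC⟩ := exists_bound_ratio hbdd (P.support_factor_subset hi hk p)
  exact memLp_two_of_integrable_of_bound (P.integrable_symbol i hi k hk p) hC

theorem memLp_top_ratio_factor {i : ℕ} (hi : i ∈ Finset.Icc 2 P.N) {k : ℕ} (hk : k ∈ P.J i)
    (p : Fin i) : MemLp (P.ratio (P.factor i k p)) ∞ volume :=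
  P.memLp_top_ratio (exists_bound_ratio hbdd (P.support_factor_subset hi hk p))

end Bounded

theorem fourier_opL (u : P.Hl) : (𝓕 (P.opL u) : L2 m) = P.weight u :=
  FourierTransform.fourier_fourierInv_eq (P.weight u)

theorem coeFn_fourier_opL (u : P.Hl) :
    (𝓕 (P.opL u) : L2 m) =ᵐ[volume] fun ξ => symbol P.lin ξ * (𝓕 (P.toL2 u) : L2 m) ξ := by
  rw [fourier_opL]
  exact (P.memLp_symbol_mul u).coeFn_toLp

theorem norm_opL (u : P.Hl) : ‖P.opL u‖ = ‖u‖ := by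
  rw [← Lp.norm_fourier_eq, fourier_opL]
  rfl

theorem mulOp_ratio_fourier_opL {Q : MvPolynomial (Fin m) ℂ} (hQ : MemLp (P.ratio Q) ∞ volume)
    (u : P.Hl) : mulOp (P.ratio Q) (𝓕 (P.opL u) : L2 m) =ᵐ[volume]
      fun ξ => symbol Q ξ * (𝓕 (P.toL2 u) : L2 m) ξ := by
  filter_upwards [coeFn_mulOp hQ (𝓕 (P.opL u) : L2 m), P.coeFn_fourier_opL u] with ξ h1 h2
  rw [h1, h2, ratio, ← mul_assoc, div_mul_cancel₀ _ (P.symbol_lin_ne_zero ξ)]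

/-- Write `g û = (g/l)(l û)`: with `g/l` bounded this is in `L²`, so the default value of `diffOp`
is never taken on `H^l`. -/
theorem diffOp_toL2 {Q : MvPolynomial (Fin m) ℂ} (hQ : MemLp (P.ratio Q) ∞ volume) (u : P.Hl) :
    diffOp Q (P.toL2 u) = fourierMult (P.ratio Q) (P.opL u) := by
  have h1 := P.mulOp_ratio_fourier_opL hQ u
  have h2 : MemLp (fun ξ => symbol Q ξ * (𝓕 (P.toL2 u) : L2 m) ξ) 2 volume :=
    (Lp.memLp (mulOp (P.ratio Q) (𝓕 (P.opL u) : L2 m))).ae_eq h1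
  rw [diffOp, dif_pos h2, fourierMult_apply]
  congr 1
  refine Lp.ext ?_
  filter_upwards [h1, h2.coeFn_toLp] with ξ a b
  rw [a, b]

/-! ### Differentiability -/

section Differentiable

variable {P} (hbdd : ∀ α ∈ P.JG, ∃ C : ℝ, ∀ ξ, ‖P.symbolDL α ξ‖ ≤ C)
include hbdd

theorem exists_essBound_factor {i : ℕ} (hi : i ∈ Finset.Icc 2 P.N) {k : ℕ} (hk : k ∈ P.J i)
    (p : Fin i) : ∃ C : ℝ, ∀ u : P.Hl, ∀ᵐ x,
      ‖(fourierMult (P.ratio (P.factor i k p)) ∘L P.opL) u x‖ ≤ C * ‖u‖ := by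
  obtain ⟨C, hC⟩ := exists_essBound_fourierMult (memLp_two_ratio_factor hbdd hi hk p)
    (memLp_top_ratio_factor hbdd hi hk p)
  refine ⟨C, fun u => ?_⟩
  rw [← norm_opL]
  exact hC (P.opL u)

/-- The coefficient `∏_{q ≠ p} 𝔾^qᵢₖ u₀` of `𝔾ᵖᵢₖ` in the linearization. -/
def cofactor (P : Equation m) (u₀ : P.Hl) (i k : ℕ) (p : Fin i) (x : EuclideanSpace ℝ (Fin m)) :
    ℂ :=
  ∏ q ∈ Finset.univ.erase p, diffOp (P.factor i k q) (P.toL2 u₀) x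

theorem exists_essBound_diffOp {i : ℕ} (hi : i ∈ Finset.Icc 2 P.N) {k : ℕ} (hk : k ∈ P.J i)
    (u₀ : P.Hl) : ∃ C : Fin i → ℝ, ∀ p, ∀ᵐ x, ‖diffOp (P.factor i k p) (P.toL2 u₀) x‖ ≤ C p := by
  have h : ∀ p, ∃ C : ℝ, ∀ᵐ x, ‖diffOp (P.factor i k p) (P.toL2 u₀) x‖ ≤ C := by
    intro p
    obtain ⟨C, hC⟩ := exists_essBound_factor hbdd hi hk p
    exact ⟨C * ‖u₀‖, by rw [P.diffOp_toL2 (memLp_top_ratio_factor hbdd hi hk p)]; exact hC u₀⟩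
  choose C hC using h
  exact ⟨C, hC⟩

theorem memLp_top_diffOp {i : ℕ} (hi : i ∈ Finset.Icc 2 P.N) {k : ℕ} (hk : k ∈ P.J i)
    (u₀ : P.Hl) (p : Fin i) : MemLp (diffOp (P.factor i k p) (P.toL2 u₀)) ∞ volume := by
  obtain ⟨C, hC⟩ := exists_essBound_diffOp hbdd hi hk u₀
  exact memLp_top_of_bound (Lp.aestronglyMeasurable _) (C p) (hC p)

theorem memLp_top_cofactor {i : ℕ} (hi : i ∈ Finset.Icc 2 P.N) {k : ℕ} (hk : k ∈ P.J i)
    (u₀ : P.Hl) (p : Fin i) : MemLp (P.cofactor u₀ i k p) ∞ volume := by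
  obtain ⟨C, hC⟩ := exists_essBound_diffOp hbdd hi hk u₀
  exact memLp_top_prod _ _ hC

theorem mulOp_coeffV (u₀ : P.Hl) (α : Fin m →₀ ℕ) :
    mulOp (P.coeffV u₀ α) = ∑ i ∈ Finset.Icc 2 P.N, ∑ k ∈ P.J i, ∑ p : Fin i,
      (P.factor i k p).coeff α • mulOp (P.cofactor u₀ i k p) := by
  have h3 : ∀ i ∈ Finset.Icc 2 P.N, ∀ k ∈ P.J i, ∀ p ∈ (Finset.univ : Finset (Fin i)),
      MemLp (fun x => (P.factor i k p).coeff α * P.cofactor u₀ i k p x) ∞ volume :=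
    fun i hi k hk p _ => (memLp_top_cofactor hbdd hi hk u₀ p).const_mul _
  have h2 := fun i hi k hk => memLp_finsetSum Finset.univ (h3 i hi k hk)
  have h1 := fun i hi => memLp_finsetSum (P.J i) (h2 i hi)
  refine (mulOp_finsetSum _ _ h1).trans (Finset.sum_congr rfl fun i hi => ?_)
  refine (mulOp_finsetSum _ _ (h2 i hi)).trans (Finset.sum_congr rfl fun k hk => ?_)
  refine (mulOp_finsetSum _ _ (h3 i hi k hk)).trans (Finset.sum_congr rfl fun p _ => ?_)
  exact mulOp_const_mul _ (memLp_top_cofactor hbdd hi hk u₀ p)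

/-- Summation over multi-indices versus summation over the monomials of `𝔾`. -/
theorem sum_coeffV_eq {V W : Type*} [NormedAddCommGroup V] [NormedSpace ℂ V]
    [NormedAddCommGroup W] [NormedSpace ℂ W] (Ψ : (L2 m →L[ℂ] L2 m) →ₗ[ℂ] (V →L[ℂ] W))
    {V' : Type*} [NormedAddCommGroup V'] [NormedSpace ℂ V'] (D : (Fin m →₀ ℕ) → V' →L[ℂ] V)
    (u₀ : P.Hl) :
    ∑ α ∈ P.JG, Ψ (mulOp (P.coeffV u₀ α)) ∘L D α =
      ∑ i ∈ Finset.Icc 2 P.N, ∑ k ∈ P.J i, ∑ p : Fin i,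
        Ψ (mulOp (P.cofactor u₀ i k p)) ∘L ∑ α ∈ P.JG, (P.factor i k p).coeff α • D α := by
  simp_rw [mulOp_coeffV hbdd, map_sum, map_smul]
  ext1 h
  simp only [sum_apply, ContinuousLinearMap.comp_apply, smul_apply, map_sum, map_smul]
  rw [Finset.sum_comm]
  refine Finset.sum_congr rfl fun i _ => ?_
  rw [Finset.sum_comm]
  refine Finset.sum_congr rfl fun k _ => ?_
  rw [Finset.sum_comm]

/-- Regrouping by monomials lets the product rule apply to one product at a time. -/
theorem opDG_eq_sum (u₀ : P.Hl) :
    P.opDG u₀ = ∑ i ∈ Finset.Icc 2 P.N, ∑ k ∈ P.J i, ∑ p : Fin i,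
      mulOp (P.cofactor u₀ i k p) ∘L fourierMult (P.ratio (P.factor i k p)) ∘L P.opL := by
  have h := sum_coeffV_eq hbdd LinearMap.id (fun α => P.opDL α ∘L P.opL) u₀
  simp only [LinearMap.id_apply] at h
  refine h.trans (Finset.sum_congr rfl fun i hi => Finset.sum_congr rfl fun k hk =>
    Finset.sum_congr rfl fun p _ => ?_)
  rw [fourierMult_ratio hbdd (P.support_factor_subset hi hk p)]
  congr 1
  ext1 h
  simp only [sum_apply, ContinuousLinearMap.comp_apply, smul_apply]

theorem hasFDerivAt_opG (u₀ : P.Hl) : HasFDerivAt P.opG (P.opDG u₀) u₀ := by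
  rw [opDG_eq_sum hbdd]
  refine HasFDerivAt.fun_sum fun i hi => HasFDerivAt.fun_sum fun k hk => ?_
  have : Nonempty (Fin i) := ⟨⟨0, by have := (Finset.mem_Icc.1 hi).1; omega⟩⟩
  have hT := fun (p : Fin i) (u : P.Hl) =>
    P.diffOp_toL2 (memLp_top_ratio_factor hbdd hi hk p) u
  have h := hasFDerivAt_prodL2 (fun p : Fin i => fourierMult (P.ratio (P.factor i k p)) ∘L P.opL)
    (exists_essBound_factor hbdd hi hk) u₀
  simp only [ContinuousLinearMap.comp_apply, ← hT] at h
  exact h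

theorem hasFDerivAt_opF (u₀ : P.Hl) : HasFDerivAt P.opF (P.opDF u₀) u₀ :=
  (P.opL.hasFDerivAt.add (hasFDerivAt_opG hbdd u₀)).sub_const P.psi

end Differentiable

end Equation

/-! ### Completeness of the Fourier modes on the cube -/

section Torus

variable {m : ℕ}

/-- The Haar probability measure on `ℝ / ℤ`. -/
local instance : MeasureSpace UnitAddCircle := ⟨AddCircle.haarAddCircle⟩

/-- The measurable bijection from the torus to `(-d, d]ᵐ`. -/
def torusToCube (m : ℕ) (d : ℝ) (t : UnitAddTorus (Fin m)) : EuclideanSpace ℝ (Fin m) :=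
  (2 * d) • WithLp.toLp 2 (UnitAddTorus.measurableEquivPiIoc (fun _ : Fin m => (-1 / 2 : ℝ)) t).1

/-- The half-open cube `(-d, d]ᵐ`. -/
def halfOpenCube (m : ℕ) (d : ℝ) : Set (EuclideanSpace ℝ (Fin m)) :=
  {x | ∀ j, x j ∈ Set.Ioc (-d) d}

theorem measurable_torusToCube (d : ℝ) : Measurable (torusToCube m d) := by
  unfold torusToCube
  have h := (UnitAddTorus.measurableEquivPiIoc (fun _ : Fin m => (-1 / 2 : ℝ))).measurable
  fun_prop

/-- The fundamental domain `(-1/2, 1/2]ᵐ` is scaled by `2d`, which gives `c = (2d)^{-m}`. Later only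
`c ≠ 0, ∞` matters, because null sets and vanishing integrals are all that is transported. -/
theorem map_torusToCube {d : ℝ} (hd : 0 < d) :
    ∃ c : ℝ≥0∞, c ≠ 0 ∧ c ≠ ∞ ∧ Measure.map (torusToCube m d) volume =
      c • (volume : Measure (EuclideanSpace ℝ (Fin m))).restrict (halfOpenCube m d) := by
  have hd2 : (0 : ℝ) < 2 * d := by linarith
  have h1 := UnitAddTorus.measurePreserving_equivPiIoc (fun _ : Fin m => (-1 / 2 : ℝ))
  have hbox : MeasurableSet {x : Fin m → ℝ | ∀ i, x i ∈ Set.Ioc (-1 / 2 : ℝ) (-1 / 2 + 1)} :=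
    MeasurableSet.univ_pi' fun i => measurableSet_Ioc
  have h2 := measurePreserving_subtype_coe (μa := (volume : Measure (Fin m → ℝ))) hbox
  have h3 := (PiLp.volume_preserving_toLp (Fin m)).restrict_image_emb
    (MeasurableEquiv.toLp 2 (Fin m → ℝ)).measurableEmbedding
    {x : Fin m → ℝ | ∀ i, x i ∈ Set.Ioc (-1 / 2 : ℝ) (-1 / 2 + 1)}
  have h4 := (h3.comp (h2.comp h1)).map_eq
  have hsm : Measurable fun x : EuclideanSpace ℝ (Fin m) => (2 * d) • x := by fun_prop
  have hme : MeasurableEmbedding fun x : EuclideanSpace ℝ (Fin m) => (2 * d) • x :=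
    (Homeomorph.smulOfNeZero (2 * d) hd2.ne').measurableEmbedding
  have h5 : Measure.map (torusToCube m d) volume = Measure.map
      (fun x : EuclideanSpace ℝ (Fin m) => (2 * d) • x) (volume.restrict (WithLp.toLp 2 ''
        {x : Fin m → ℝ | ∀ i, x i ∈ Set.Ioc (-1 / 2 : ℝ) (-1 / 2 + 1)})) := by
    rw [← h4, Measure.map_map hsm (h3.comp (h2.comp h1)).measurable]
    rfl
  refine ⟨ENNReal.ofReal |((2 * d) ^ Module.finrank ℝ (EuclideanSpace ℝ (Fin m)))⁻¹|, ?_,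
    ENNReal.ofReal_ne_top, ?_⟩
  · rw [Ne, ENNReal.ofReal_eq_zero, not_le]
    positivity
  · rw [h5, ← Measure.restrict_smul, ← Measure.map_addHaar_smul volume hd2.ne',
      hme.restrict_map]
    congr 2
    ext x
    simp only [Set.mem_image, Set.mem_ofPred_eq, Set.mem_preimage, halfOpenCube, Set.mem_Ioc,
      PiLp.smul_apply, smul_eq_mul]
    constructor
    · rintro ⟨y, hy, rfl⟩ j
      have := hy j
      constructor <;> simp only [] <;> nlinarith
    · intro h
      refine ⟨x.ofLp, fun j => ?_, rfl⟩
      obtain ⟨ha, hb⟩ := h j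
      constructor <;> nlinarith

theorem mFourier_neg_eq {d : ℝ} (hd : 0 < d) (n : Fin m → ℤ) (t : UnitAddTorus (Fin m)) :
    UnitAddTorus.mFourier (-n) t = (starRingEnd ℂ) (expMode d n (torusToCube m d t)) := by
  rw [UnitAddTorus.mFourier_neg]
  congr 1
  have ht : t = fun i =>
      (((UnitAddTorus.measurableEquivPiIoc (fun _ : Fin m => (-1 / 2 : ℝ)) t).1 i : ℝ) :
        UnitAddCircle) :=
    ((UnitAddTorus.measurableEquivPiIoc
      (fun _ : Fin m => (-1 / 2 : ℝ))).symm_apply_apply t).symm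
  conv_lhs => rw [ht]
  rw [UnitAddTorus.mFourier, ContinuousMap.coe_mk, expMode, torusToCube]
  simp_rw [fourier_coe_apply]
  rw [← Complex.exp_sum]
  congr 1
  push_cast
  rw [Finset.mul_sum]
  refine Finset.sum_congr rfl fun j _ => ?_
  have : (d : ℂ) ≠ 0 := by exact_mod_cast hd.ne'
  simp only [freq, PiLp.smul_apply, smul_eq_mul]
  push_cast
  field_simp

theorem cube_subset_halfOpenCube (d : ℝ) : cube m d ⊆ halfOpenCube m d :=
  fun _ hx j => Set.Ioo_subset_Ioc_self (hx j)

/-- A square integrable function on the cube all of whose Fourier coefficients vanish is zero. -/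
theorem eq_zero_of_forall_integral_expMode_eq_zero {d : ℝ} (hd : 0 < d) (f : L2 m)
    (hf : ∀ᵐ x, x ∉ cube m d → f x = 0)
    (h : ∀ n, ∫ x in cube m d, f x * (starRingEnd ℂ) (expMode d n x) = 0) : f = 0 := by
  obtain ⟨c, hc0, hct, hc⟩ := map_torusToCube (m := m) hd
  have hmeas := measurable_torusToCube (m := m) d
  have hLp : MemLp (f ∘ torusToCube m d) 2 volume := by
    rw [← memLp_map_measure_iff (by rw [hc]; exact ((Lp.memLp f).restrict _).1.smul_measure c)
      hmeas.aemeasurable, hc]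
    exact ((Lp.memLp f).restrict _).smul_measure hct
  have hcoef : ∀ n, UnitAddTorus.mFourierCoeff (f ∘ torusToCube m d) n = 0 := by
    intro n
    have hG : AEStronglyMeasurable (fun x => f x * (starRingEnd ℂ) (expMode d n x)) volume :=
      (Lp.aestronglyMeasurable f).mul
        (Complex.continuous_conj.comp (continuous_expMode d n)).aestronglyMeasurable
    have h1 : UnitAddTorus.mFourierCoeff (f ∘ torusToCube m d) n =
        ∫ t, f (torusToCube m d t) * (starRingEnd ℂ) (expMode d n (torusToCube m d t)) := by
      rw [UnitAddTorus.mFourierCoeff]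
      refine integral_congr_ae (Filter.Eventually.of_forall fun t => ?_)
      simp only [mFourier_neg_eq hd, smul_eq_mul, Function.comp_apply]
      exact mul_comm _ _
    have h2 := integral_map (φ := torusToCube m d) (μ := volume) hmeas.aemeasurable
      (f := fun x => f x * (starRingEnd ℂ) (expMode d n x))
      (by rw [hc]; exact hG.restrict.smul_measure c)
    -- The torus corresponds to the half-open cube; passing to the open one costs nothing since `f`
    -- vanishes a.e. off it.
    rw [h1, ← h2, hc, integral_smul_measure, setIntegral_eq_of_subset_of_ae_sdiff_eq_zero
        (s := cube m d) (t := halfOpenCube m d) _ (cube_subset_halfOpenCube d) _, h n, smul_zero]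
    · refine MeasurableSet.nullMeasurableSet ?_
      have : halfOpenCube m d =
          ⋂ j, (fun x : EuclideanSpace ℝ (Fin m) => x j) ⁻¹' Set.Ioc (-d) d := by
        ext x; simp [halfOpenCube]
      rw [this]
      exact MeasurableSet.iInter fun j => (by fun_prop : Measurable fun
        x : EuclideanSpace ℝ (Fin m) => x j) measurableSet_Ioc
    · filter_upwards [hf] with x hx hxd
      rw [hx hxd.2, zero_mul]
  -- Completeness of the exponentials on the torus.
  have hzero : hLp.toLp = 0 := by
    refine UnitAddTorus.mFourierBasis.repr.map_eq_zero_iff.1 ?_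
    ext n
    refine (UnitAddTorus.mFourierBasis_repr _ n).trans (Eq.trans ?_ (hcoef n))
    refine integral_congr_ae ?_
    filter_upwards [hLp.coeFn_toLp] with t a
    rw [a]
  have hae : ∀ᵐ t, f (torusToCube m d t) = 0 := by
    have h1 := (Lp.eq_zero_iff_ae_eq_zero (f := hLp.toLp)).1 hzero
    filter_upwards [hLp.coeFn_toLp, h1] with t a b
    exact a.symm.trans b
  have hset : MeasurableSet {x | f x = 0} :=
    (Lp.stronglyMeasurable f).measurable (measurableSet_singleton 0)
  have hae2 := (ae_map_iff hmeas.aemeasurable hset).2 hae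
  rw [hc, Measure.ae_ennreal_smul_measure_iff hc0] at hae2
  rw [Lp.eq_zero_iff_ae_eq_zero]
  have hae3 := ae_imp_of_ae_restrict (ae_restrict_of_ae_restrict_of_subset
    (cube_subset_halfOpenCube d) hae2)
  filter_upwards [hae3, hf] with x h1 h2
  by_cases hx : x ∈ cube m d
  · exact h1 hx
  · exact h2 hx

end Torus

/-! ### Synthesis and analysis on the cube -/

section Synth

variable {m : ℕ} {d : ℝ}

theorem clm_ext_single {V : Type*} [NormedAddCommGroup V] [NormedSpace ℂ V]
    {S T : Ell2 m →L[ℂ] V} (h : ∀ n, S (lp.single 2 n 1) = T (lp.single 2 n 1)) : S = T := by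
  ext1 U
  have h1 := lp.hasSum_single (by norm_num : (2 : ℝ≥0∞) ≠ ∞) U
  have h2 := h1.mapL S
  have h3 := h1.mapL T
  have hs : ∀ n, (lp.single 2 n (U n) : Ell2 m) = U n • lp.single 2 n (1 : ℂ) := fun n => by
    rw [← lp.single_smul, smul_eq_mul, mul_one]
  have he : (fun n => S (lp.single 2 n (U n))) = fun n => T (lp.single 2 n (U n)) := by
    funext n
    rw [hs, map_smul, map_smul, h]
  rw [he] at h2
  exact h2.unique h3

theorem synth_single (hd : 0 < d) (n : Fin m → ℤ) :
    synth hd (lp.single 2 n (1 : ℂ)) = mode d n := by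
  simp [synth]

theorem norm_synth (hd : 0 < d) (V : Ell2 m) : ‖synth hd V‖ = ‖V‖ :=
  ((orthonormal_mode (m := m) hd).orthogonalFamily.linearIsometry).norm_map V

theorem adjoint_synth_comp_synth (hd : 0 < d) :
    (synth (m := m) hd).adjoint ∘L synth hd = 1 := by
  ext1 V
  refine ext_inner_left ℂ fun W => ?_
  rw [ContinuousLinearMap.comp_apply, ContinuousLinearMap.adjoint_inner_right]
  exact ((orthonormal_mode (m := m) hd).orthogonalFamily.linearIsometry).inner_map_map W V

theorem adjoint_synth_apply_synth (hd : 0 < d) (V : Ell2 m) :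
    (synth (m := m) hd).adjoint (synth hd V) = V :=
  DFunLike.congr_fun (adjoint_synth_comp_synth hd) V

theorem cutoff_eq_self {f : L2 m} (hf : ∀ᵐ x, x ∉ cube m d → f x = 0) : cutoff m d f = f := by
  refine Lp.ext ?_
  filter_upwards [coeFn_cutoff d f, hf] with x h1 h2
  rw [h1]
  by_cases hx : x ∈ cube m d
  · rw [Set.indicator_of_mem hx]
  · rw [Set.indicator_of_notMem hx, h2 hx]

theorem cutoff_ae_zero (d : ℝ) (f : L2 m) : ∀ᵐ x, x ∉ cube m d → cutoff m d f x = 0 := by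
  filter_upwards [coeFn_cutoff d f] with x h1 hx
  rw [h1, Set.indicator_of_notMem hx]

theorem cutoff_cutoff (d : ℝ) (f : L2 m) : cutoff m d (cutoff m d f) = cutoff m d f :=
  cutoff_eq_self (cutoff_ae_zero d f)

theorem cutoff_comp_synth (hd : 0 < d) : cutoff m d ∘L synth hd = synth hd := by
  refine clm_ext_single fun n => ?_
  rw [ContinuousLinearMap.comp_apply, synth_single]
  refine cutoff_eq_self ?_
  filter_upwards [(memLp_modeFun (m := m) d n).coeFn_toLp] with x h hx
  rw [mode, h, modeFun, Set.indicator_of_notMem hx]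

theorem inner_mode (d : ℝ) (n : Fin m → ℤ) (f : L2 m) :
    inner ℂ (mode d n : L2 m) f = ((Real.sqrt ((2 * d) ^ m) : ℝ) : ℂ)⁻¹ *
      ∫ x in cube m d, f x * (starRingEnd ℂ) (expMode d n x) := by
  rw [mode_eq_smul, inner_smul_left, map_inv₀, Complex.conj_ofReal, L2.inner_def,
    ← integral_indicator (measurableSet_cube m d)]
  congr 1
  refine integral_congr_ae ?_
  filter_upwards [(memLp_expMode (m := m) d n).coeFn_toLp] with x hx
  rw [hx]
  by_cases hx' : x ∈ cube m d <;> simp [hx', RCLike.inner_apply]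

theorem inner_mode_cutoff (d : ℝ) (n : Fin m → ℤ) (f : L2 m) :
    inner ℂ (mode d n : L2 m) (cutoff m d f) = inner ℂ (mode d n : L2 m) f := by
  rw [inner_mode, inner_mode]
  congr 1
  refine setIntegral_congr_ae (measurableSet_cube m d) ?_
  filter_upwards [coeFn_cutoff d f] with x h hx
  rw [h, Set.indicator_of_mem hx]

theorem eq_zero_of_forall_inner_mode_eq_zero (hd : 0 < d) {f : L2 m} (hf : cutoff m d f = f)
    (h : ∀ n, inner ℂ (mode d n : L2 m) f = 0) : f = 0 := by
  refine eq_zero_of_forall_integral_expMode_eq_zero hd f (hf ▸ cutoff_ae_zero d f) fun n => ?_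
  have h1 := h n
  rw [inner_mode] at h1
  refine (mul_eq_zero.1 h1).resolve_left (inv_ne_zero ?_)
  have : (0 : ℝ) < Real.sqrt ((2 * d) ^ m) := by positivity
  exact_mod_cast this.ne'

/-- The Fourier series of `f` converges to `𝟙_{Ω₀} f`. -/
theorem synth_comp_adjoint (hd : 0 < d) :
    synth (m := m) hd ∘L (synth hd).adjoint = cutoff m d := by
  ext1 f
  rw [← sub_eq_zero]
  -- The difference is supported in the cube and orthogonal to every mode, so completeness applies.
  refine eq_zero_of_forall_inner_mode_eq_zero hd ?_ fun n => ?_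
  · rw [map_sub, cutoff_cutoff, ContinuousLinearMap.comp_apply, ← ContinuousLinearMap.comp_apply
      (cutoff m d), cutoff_comp_synth]
  · rw [inner_sub_right, inner_mode_cutoff, ContinuousLinearMap.comp_apply, ← synth_single hd,
      ← ContinuousLinearMap.adjoint_inner_right (synth hd), adjoint_synth_apply_synth,
      ContinuousLinearMap.adjoint_inner_right, sub_self]

theorem adjoint_synth_comp_cutoff (hd : 0 < d) :
    (synth (m := m) hd).adjoint ∘L cutoff m d = (synth hd).adjoint := by
  rw [← synth_comp_adjoint hd, ← ContinuousLinearMap.comp_assoc, adjoint_synth_comp_synth]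
  rfl

/-- Between `S` and `T` one must insert `synth ∘ synth^* = 𝟙_{Ω₀}`, which is harmless exactly when
the range of `T` is supported in the cube. -/
theorem fourierRep_comp (hd : 0 < d) (S : L2 m →L[ℂ] L2 m) {T : L2 m →L[ℂ] L2 m}
    (hT : cutoff m d ∘L T = T) : fourierRep hd (S ∘L T) = fourierRep hd S ∘L fourierRep hd T := by
  unfold fourierRep
  conv_lhs => rw [← hT, ← synth_comp_adjoint hd]
  rfl

theorem ofFourierRep_fourierRep (hd : 0 < d) (T : L2 m →L[ℂ] L2 m) :
    ofFourierRep hd (fourierRep hd T) = cutoff m d ∘L T ∘L cutoff m d := by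
  rw [← synth_comp_adjoint hd]
  rfl

theorem norm_ofFourierRep_le (hd : 0 < d) (B : Ell2 m →L[ℂ] Ell2 m) :
    ‖ofFourierRep hd B‖ ≤ ‖B‖ := by
  have h1 : ‖(synth (m := m) hd)‖ ≤ 1 :=
    ContinuousLinearMap.opNorm_le_bound _ zero_le_one fun V => by rw [norm_synth, one_mul]
  have h2 : ‖(synth (m := m) hd).adjoint‖ ≤ 1 := by
    rw [LinearIsometryEquiv.norm_map]; exact h1
  calc ‖ofFourierRep hd B‖ ≤ ‖synth (m := m) hd‖ * (‖B‖ * ‖(synth (m := m) hd).adjoint‖) :=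
        (ContinuousLinearMap.opNorm_comp_le _ _).trans
          (mul_le_mul_of_nonneg_left (ContinuousLinearMap.opNorm_comp_le _ _) (norm_nonneg _))
    _ ≤ 1 * (‖B‖ * 1) := by gcongr
    _ = ‖B‖ := by ring

end Synth

/-! ### Multiplication operators as discrete convolutions -/

section Conv

variable {m : ℕ} {d : ℝ}

theorem convOp_eq {U : (Fin m → ℤ) → ℂ} {T : Ell2 m →L[ℂ] Ell2 m}
    (h : ∀ (V : Ell2 m) n, HasSum (fun k => U k * V (n - k)) (T V n)) : convOp U = T := by
  have hex : ∃ T : Ell2 m →L[ℂ] Ell2 m, ∀ (V : Ell2 m) (n : Fin m → ℤ),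
      HasSum (fun k => U k * V (n - k)) (T V n) := ⟨T, h⟩
  rw [convOp, dif_pos hex]
  ext V n
  exact (hex.choose_spec V n).unique (h V n)

theorem expMode_mul_conj (d : ℝ) (n k : Fin m → ℤ) (x : EuclideanSpace ℝ (Fin m)) :
    expMode d k x * (starRingEnd ℂ) (expMode d n x) = (starRingEnd ℂ) (expMode d (n - k) x) := by
  rw [mul_comm, conj_expMode_mul]
  unfold expMode freq
  rw [← Complex.exp_conj, ← Complex.exp_sum]
  congr 1
  simp only [map_mul, Complex.conj_I, Complex.conj_ofReal, map_ofNat]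
  push_cast
  rw [Finset.mul_sum]
  refine Finset.sum_congr rfl fun j _ => ?_
  simp only [Pi.sub_apply]
  push_cast
  ring

/-- The matrix is Toeplitz: entry `(n, k)` is the coefficient of `w` at `n - k`. Expanding `V` in
unit vectors and substituting `k ↦ n - k` gives the convolution sum. -/
theorem fourierRep_mulOp (hd : 0 < d) {w : EuclideanSpace ℝ (Fin m) → ℂ}
    (hw : MemLp w ∞ volume) : fourierRep hd (mulOp w) = convOp (fourierCoeffs d w) := by
  have hs : ∀ n k, fourierRep hd (mulOp w) (lp.single 2 k 1) n = fourierCoeffs d w (n - k) := by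
    intro n k
    rw [fourierRep_single, fourierCoeffs]
    congr 1
    refine setIntegral_congr_ae (measurableSet_cube m d) ?_
    filter_upwards [coeFn_mulOp hw (memLp_expMode d k).toLp, (memLp_expMode d k).coeFn_toLp]
      with x h1 h2 hx
    rw [h1, h2, Set.indicator_of_mem hx, mul_assoc, expMode_mul_conj]
  refine (convOp_eq fun V n => ?_).symm
  have h1 := (lp.hasSum_single (by norm_num : (2 : ℝ≥0∞) ≠ ∞) V).mapL (fourierRep hd (mulOp w))
  have h2 := h1.mapL (lp.evalCLM ℂ (fun _ : Fin m → ℤ => ℂ) 2 n)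
  have h3 := (Equiv.subLeft n).hasSum_iff.2 h2
  have he : (fun k => fourierCoeffs d w k * V (n - k)) =
      (fun k => lp.evalCLM ℂ (fun _ : Fin m → ℤ => ℂ) 2 n
        (fourierRep hd (mulOp w) (lp.single 2 k (V k)))) ∘ Equiv.subLeft n := by
    funext k
    have hsm : (lp.single 2 (n - k) (V (n - k)) : Ell2 m) =
        V (n - k) • lp.single 2 (n - k) (1 : ℂ) := by
      rw [← lp.single_smul, smul_eq_mul, mul_one]
    rw [Function.comp_apply, Equiv.subLeft_apply, hsm, map_smul, map_smul, smul_eq_mul]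
    change _ = V (n - k) * fourierRep hd (mulOp w) (lp.single 2 (n - k) 1) n
    rw [hs, sub_sub_cancel, mul_comm]
  rw [he]
  exact h3

/-- Products of multiplication operators supported on the cube. -/
theorem fourierRep_mulOp_list_prod (hd : 0 < d) {ι : Type*}
    (w : ι → EuclideanSpace ℝ (Fin m) → ℂ) (hw : ∀ q, MemLp (w q) ∞ volume)
    (hsupp : ∀ q, ∀ᵐ x, x ∉ cube m d → w q x = 0) {l : List ι} (hl : l ≠ []) :
    fourierRep hd (mulOp fun x => (l.map fun q => w q x).prod) =
      (l.map fun q => convOp (fourierCoeffs d (w q))).prod ∧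
      MemLp (fun x => (l.map fun q => w q x).prod) ∞ volume ∧
      ∀ᵐ x, x ∉ cube m d → (l.map fun q => w q x).prod = 0 := by
  induction l with
  | nil => exact absurd rfl hl
  | cons q l ih =>
    by_cases hl0 : l = []
    · subst hl0
      simpa using ⟨fourierRep_mulOp hd (hw q), hw q, hsupp q⟩
    · obtain ⟨h1, h2, h3⟩ := ih hl0
      simp only [List.map_cons, List.prod_cons]
      refine ⟨?_, h2.mul (hw q), ?_⟩
      -- Multiplicativity of `fourierRep` needs the right-hand factor to be supported in the cube,
      -- which is why the support statement is part of the induction. It fails for the empty product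
      -- `1`.
      · rw [mulOp_mul (hw q) h2, fourierRep_comp hd, h1, fourierRep_mulOp hd (hw q)]
        · rfl
        · ext1 f
          refine cutoff_eq_self ?_
          filter_upwards [coeFn_mulOp h2 f, h3] with x e1 e2 hx
          exact e1.trans (by rw [e2 hx, zero_mul])
      · filter_upwards [hsupp q] with x e hx
        rw [e hx, zero_mul]

end Conv

/-! ### Locality of differential operators -/

section Locality

variable {m : ℕ} {d : ℝ}

open scoped SchwartzMap LineDeriv

/-- The formal adjoint of a differential operator, applied to a Schwartz function, vanishes on
each open set on which the Schwartz function vanishes. -/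
theorem exists_schwartz_fourierInv_eq {U : Set (EuclideanSpace ℝ (Fin m))} (hU : IsOpen U)
    (Q : MvPolynomial (Fin m) ℂ) {φ : 𝓢(EuclideanSpace ℝ (Fin m), ℂ)} (hφ : ∀ x ∈ U, φ x = 0) :
    ∃ θ : 𝓢(EuclideanSpace ℝ (Fin m), ℂ), (∀ x ∈ U, θ x = 0) ∧
      ∀ ξ, (𝓕⁻ θ) ξ = symbol Q ξ * (𝓕⁻ φ) ξ := by
  induction Q using MvPolynomial.induction_on with
  | C a =>
    refine ⟨a • φ, fun x hx => by simp [hφ x hx], fun ξ => ?_⟩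
    rw [FourierTransform.fourierInv_smul]
    simp [symbol]
  | add p q hp hq =>
    obtain ⟨θ₁, h1, e1⟩ := hp
    obtain ⟨θ₂, h2, e2⟩ := hq
    refine ⟨θ₁ + θ₂, fun x hx => by simp [h1 x hx, h2 x hx], fun ξ => ?_⟩
    rw [FourierTransform.fourierInv_add, add_apply, e1, e2]
    simp [symbol, add_mul]
  | mul_X p j hp =>
    obtain ⟨θ, h1, e1⟩ := hp
    -- Under `𝓕⁻` the derivative `∂_j` becomes multiplication by `-2πi ξ_j`, hence the sign.
    -- Differentiation preserves vanishing on an open set.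
    refine ⟨-∂_{EuclideanSpace.single j (1 : ℝ)} θ, fun x hx => ?_, fun ξ => ?_⟩
    · have h0 : (θ : EuclideanSpace ℝ (Fin m) → ℂ) =ᶠ[nhds x] fun _ => 0 := by
        filter_upwards [hU.mem_nhds hx] with y hy using h1 y hy
      rw [neg_apply, SchwartzMap.lineDerivOp_apply_eq_fderiv, h0.fderiv_eq]
      simp
    · have h0 : (𝓕⁻ (-∂_{EuclideanSpace.single j (1 : ℝ)} θ) :
          𝓢(EuclideanSpace ℝ (Fin m), ℂ)) =
          -𝓕⁻ (∂_{EuclideanSpace.single j (1 : ℝ)} θ) := by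
        rw [← neg_one_smul ℂ, FourierTransform.fourierInv_smul, neg_one_smul]
      have ht : (fun ξ : EuclideanSpace ℝ (Fin m) =>
          inner ℝ ξ (EuclideanSpace.single j (1 : ℝ))).HasTemperateGrowth := by fun_prop
      rw [h0, SchwartzMap.fourierInv_lineDerivOp_eq, neg_apply,
        smul_apply, SchwartzMap.smulLeftCLM_apply_apply ht, e1]
      simp [symbol, EuclideanSpace.inner_single_right]
      ring

/-- The closed cube `[-d, d]ᵐ`. -/
def closedCube (m : ℕ) (d : ℝ) : Set (EuclideanSpace ℝ (Fin m)) :=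
  {x | ∀ j, x j ∈ Set.Icc (-d) d}

theorem isOpen_cube (d : ℝ) : IsOpen (cube m d) := by
  have : cube m d = ⋂ j, (fun x : EuclideanSpace ℝ (Fin m) => x j) ⁻¹' Set.Ioo (-d) d := by
    ext x; simp [cube]
  rw [this]
  exact isOpen_iInter_of_finite fun j => isOpen_Ioo.preimage (by fun_prop)

theorem isClosed_closedCube (d : ℝ) : IsClosed (closedCube m d) := by
  have : closedCube m d = ⋂ j, (fun x : EuclideanSpace ℝ (Fin m) => x j) ⁻¹' Set.Icc (-d) d := by
    ext x; simp [closedCube]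
  rw [this]
  exact isClosed_iInter fun j => isClosed_Icc.preimage (by fun_prop)

theorem ae_mem_cube_of_mem_closedCube (d : ℝ) :
    ∀ᵐ x : EuclideanSpace ℝ (Fin m), x ∈ closedCube m d → x ∈ cube m d := by
  have h := Measure.univ_pi_Ioo_ae_eq_Icc (μ := fun _ : Fin m => (volume : Measure ℝ))
    (f := fun _ => -d) (g := fun _ => d)
  have h1 : ∀ᵐ y : Fin m → ℝ, y ∈ Set.Icc (fun _ => -d) (fun _ => d) →
      y ∈ Set.univ.pi fun _ => Set.Ioo (-d) d := by
    filter_upwards [h.mem_iff] with y hy using hy.2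
  filter_upwards [(PiLp.volume_preserving_ofLp (Fin m)).quasiMeasurePreserving.ae h1] with x hx hc
  intro j
  exact hx ⟨fun i => (hc i).1, fun i => (hc i).2⟩ j (Set.mem_univ j)

/-- Differential operators do not increase supports. -/
theorem ae_zero_of_fourier_eq_symbol_mul (Q : MvPolynomial (Fin m) ℂ) {u v : L2 m}
    (hv : (𝓕 v : L2 m) =ᵐ[volume] fun ξ => symbol Q ξ * (𝓕 u : L2 m) ξ)
    (hu : ∀ᵐ x, x ∉ cube m d → u x = 0) : ∀ᵐ x, x ∉ cube m d → v x = 0 := by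
  -- Testing requires an open set, so the closed cube is removed; its boundary is null.
  have h1 : ∀ᵐ x, x ∈ (closedCube m d)ᶜ → v x = 0 := by
    refine (isClosed_closedCube d).isOpen_compl.ae_eq_zero_of_integral_contDiff_smul_eq_zero
      ?_ fun g hg hgs hgU => ?_
    · exact ((Lp.memLp v).locallyIntegrable (by norm_num)).locallyIntegrableOn _
    · let φ : 𝓢(EuclideanSpace ℝ (Fin m), ℂ) := HasCompactSupport.toSchwartzMap
        (f := fun x => (g x : ℂ)) (hgs.comp_left (g := fun r : ℝ => (r : ℂ)) Complex.ofReal_zero)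
        (Complex.ofRealCLM.contDiff.comp hg)
      have hφ : ∀ x, φ x = (g x : ℂ) := fun x => rfl
      have hφ0 : ∀ x ∈ cube m d, φ x = 0 := by
        intro x hx
        have hx' : x ∉ tsupport g := fun h => hgU h fun j => Set.Ioo_subset_Icc_self (hx j)
        rw [hφ, image_eq_zero_of_notMem_tsupport hx', Complex.ofReal_zero]
      obtain ⟨θ, hθ, hθe⟩ := exists_schwartz_fourierInv_eq (isOpen_cube d) Q hφ0
      have e1 := integral_schwartz_mul_fourierInv (𝓕 v : L2 m) φ
      have e2 := integral_schwartz_mul_fourierInv (𝓕 u : L2 m) θ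
      rw [FourierTransform.fourierInv_fourier_eq] at e1 e2
      simp only [Complex.real_smul, ← hφ]
      rw [e1]
      -- The symbol moves from `v̂` to the test function, so `∫ φ v = ∫ θ u`. Here `θ` vanishes on
      -- the cube and `u` off it.
      have e3 : ∫ x, (𝓕⁻ φ) x * (𝓕 v : L2 m) x = ∫ x, (𝓕⁻ θ) x * (𝓕 u : L2 m) x := by
        refine integral_congr_ae ?_
        filter_upwards [hv] with ξ h
        rw [h, hθe]; ring
      rw [e3, ← e2]
      refine integral_eq_zero_of_ae ?_
      filter_upwards [hu] with x hx
      by_cases hxc : x ∈ cube m d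
      · simp [hθ x hxc]
      · simp [hx hxc]
  filter_upwards [h1, ae_mem_cube_of_mem_closedCube (m := m) d] with x a b hx
  exact a fun hc => hx (b hc)

theorem integrable_of_ae_zero {u : L2 m} (hu : ∀ᵐ x, x ∉ cube m d → u x = 0) :
    Integrable u := by
  have : IsFiniteMeasure (volume.restrict (cube m d)) :=
    ⟨by simpa using volume_cube_lt_top m d⟩
  have h1 : IntegrableOn u (cube m d) := ((Lp.memLp u).restrict _).integrable (by norm_num)
  refine (h1.integrable_indicator (measurableSet_cube m d)).congr ?_
  filter_upwards [hu] with x hx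
  by_cases hxc : x ∈ cube m d
  · rw [Set.indicator_of_mem hxc]
  · rw [Set.indicator_of_notMem hxc, hx hxc]

theorem fourierCoeffs_eq_fourier {u : L2 m} (hu : ∀ᵐ x, x ∉ cube m d → u x = 0)
    (n : Fin m → ℤ) :
    fourierCoeffs d u n = (((2 * d) ^ m : ℝ) : ℂ)⁻¹ *
      𝓕 (u : EuclideanSpace ℝ (Fin m) → ℂ) (freq d n) := by
  rw [fourierCoeffs, Real.fourier_eq', ← integral_indicator (measurableSet_cube m d)]
  congr 1
  refine integral_congr_ae ?_
  filter_upwards [hu] with x hx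
  by_cases hxc : x ∈ cube m d
  · rw [Set.indicator_of_mem hxc, expMode, ← Complex.exp_conj, smul_eq_mul, mul_comm]
    congr 2
    simp only [map_mul, Complex.conj_I, Complex.conj_ofReal, map_ofNat, PiLp.inner_apply,
      RCLike.inner_apply, conj_trivial]
    push_cast
    ring
  · rw [Set.indicator_of_notMem hxc, hx hxc, smul_zero]

/-- The Fourier coefficients of `Q(∂)u`, for `u` supported in the cube. -/
theorem fourierCoeffs_of_fourier_eq_symbol_mul (Q : MvPolynomial (Fin m) ℂ) {u v : L2 m}
    (hv : (𝓕 v : L2 m) =ᵐ[volume] fun ξ => symbol Q ξ * (𝓕 u : L2 m) ξ)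
    (hu : ∀ᵐ x, x ∉ cube m d → u x = 0) (n : Fin m → ℤ) :
    fourierCoeffs d v n = symbol Q (freq d n) * fourierCoeffs d u n := by
  have hv0 := ae_zero_of_fourier_eq_symbol_mul Q hv hu
  have hc : ∀ {w : L2 m}, (∀ᵐ x, x ∉ cube m d → w x = 0) →
      Continuous (𝓕 (w : EuclideanSpace ℝ (Fin m) → ℂ)) ∧
      (𝓕 w : L2 m) =ᵐ[volume] 𝓕 (w : EuclideanSpace ℝ (Fin m) → ℂ) := by
    intro w hw
    have hi := integrable_of_ae_zero hw
    refine ⟨VectorFourier.fourierIntegral_continuous Real.continuous_fourierChar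
      continuous_inner hi, ?_⟩
    have h := fourier_toLp_ae_eq (Lp.memLp w) hi
    rwa [Lp.toLp_coeFn] at h
  obtain ⟨hcv, hev⟩ := hc hv0
  obtain ⟨hcu, heu⟩ := hc hu
  -- The hypothesis holds only a.e., whereas values at the single points `ñ` are needed. Functions
  -- supported in the cube are integrable, so both sides are continuous and agree everywhere.
  have hall : 𝓕 (v : EuclideanSpace ℝ (Fin m) → ℂ) =
      fun ξ => symbol Q ξ * 𝓕 (u : EuclideanSpace ℝ (Fin m) → ℂ) ξ := by
    refine (Continuous.ae_eq_iff_eq (μ := volume) hcv ((continuous_symbol Q).mul hcu)).1 ?_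
    filter_upwards [hv, hev, heu] with ξ a b c
    rw [← b, a, c]
    rfl
  rw [fourierCoeffs_eq_fourier hv0, fourierCoeffs_eq_fourier hu, hall]
  ring

end Locality

/-! ### Diagonal operators -/

section Diag

variable {m : ℕ}

theorem diagOp_apply {σ : (Fin m → ℤ) → ℂ} (hσ : ∃ C : ℝ, ∀ n, ‖σ n‖ ≤ C) (V : Ell2 m)
    (n : Fin m → ℤ) : diagOp σ V n = σ n * V n := by
  have h : ∃ K : ℝ, 0 ≤ K ∧ ∀ n, ‖ContinuousLinearMap.mul ℂ ℂ (σ n)‖ ≤ K := by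
    obtain ⟨C, hC⟩ := hσ
    exact ⟨C, (norm_nonneg _).trans (hC 0), fun n => by simpa using hC n⟩
  rw [diagOp, dif_pos h]
  rfl

theorem diagOp_finsetSum {ι : Type*} (s : Finset ι) (c : ι → ℂ) (σ : ι → (Fin m → ℤ) → ℂ)
    (hσ : ∀ i ∈ s, ∃ C : ℝ, ∀ n, ‖σ i n‖ ≤ C) :
    diagOp (fun n => ∑ i ∈ s, c i * σ i n) = ∑ i ∈ s, c i • diagOp (σ i) := by
  have hs : ∃ C : ℝ, ∀ n, ‖∑ i ∈ s, c i * σ i n‖ ≤ C := by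
    choose! C hC using hσ
    refine ⟨∑ i ∈ s, ‖c i‖ * C i, fun n => ?_⟩
    refine (norm_sum_le _ _).trans (Finset.sum_le_sum fun i hi => ?_)
    rw [norm_mul]
    exact mul_le_mul_of_nonneg_left (hC i hi n) (norm_nonneg _)
  ext V n
  rw [diagOp_apply hs, sum_apply, lp.coeFn_sum, Finset.sum_apply, Finset.sum_mul]
  refine Finset.sum_congr rfl fun i hi => ?_
  rw [smul_apply, lp.coeFn_smul, Pi.smul_apply, diagOp_apply (hσ i hi), smul_eq_mul, mul_assoc]

end Diag

/-! ### Orthogonal splitting of `L²` along the cube -/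

section Norm

variable {m : ℕ} {d : ℝ}

/-- Pythagoras: functions vanishing on the cube are orthogonal to all modes. -/
theorem norm_sub_cutoff_add_synth (hd : 0 < d) (f : L2 m) (V : Ell2 m) :
    ‖(f - cutoff m d f) + synth hd V‖ ^ 2 = ‖f - cutoff m d f‖ ^ 2 + ‖V‖ ^ 2 := by
  have h : inner ℂ (f - cutoff m d f) (synth hd V) = 0 := by
    rw [← ContinuousLinearMap.adjoint_inner_left, map_sub, ← ContinuousLinearMap.comp_apply,
      adjoint_synth_comp_cutoff, sub_self, inner_zero_left]
  rw [sq, norm_add_sq_eq_norm_sq_add_norm_sq_of_inner_eq_zero _ _ h, norm_synth, sq, sq]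

/-- The operator is block diagonal, the identity off the cube and unitarily equivalent to `B` on it.
-/
theorem norm_sub_cutoff_add_ofFourierRep_le (hd : 0 < d) (B : Ell2 m →L[ℂ] Ell2 m) :
    ‖1 - cutoff m d + ofFourierRep hd B‖ ≤ max 1 ‖B‖ := by
  refine ContinuousLinearMap.opNorm_le_bound _ (by positivity) fun f => ?_
  have h1 := norm_sub_cutoff_add_synth hd f (B ((synth hd).adjoint f))
  have h2 := norm_sub_cutoff_add_synth hd f ((synth hd).adjoint f)
  rw [← ContinuousLinearMap.comp_apply (synth hd), synth_comp_adjoint, sub_add_cancel] at h2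
  have h3 : ‖B ((synth hd).adjoint f)‖ ≤ max 1 ‖B‖ * ‖(synth hd).adjoint f‖ :=
    (B.le_opNorm _).trans (mul_le_mul_of_nonneg_right (le_max_right _ _) (norm_nonneg _))
  have h4 : ‖f - cutoff m d f‖ ≤ max 1 ‖B‖ * ‖f - cutoff m d f‖ :=
    le_mul_of_one_le_left (norm_nonneg _) (le_max_left _ _)
  refine le_of_sq_le_sq ?_ (by positivity)
  calc ‖(1 - cutoff m d + ofFourierRep hd B) f‖ ^ 2
      = ‖f - cutoff m d f‖ ^ 2 + ‖B ((synth hd).adjoint f)‖ ^ 2 := h1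
    _ ≤ (max 1 ‖B‖ * ‖f - cutoff m d f‖) ^ 2 +
          (max 1 ‖B‖ * ‖(synth hd).adjoint f‖) ^ 2 := by gcongr
    _ = (max 1 ‖B‖ * ‖f‖) ^ 2 := by rw [mul_pow _ ‖f‖, h2]; ring

end Norm

/-! ### Transfer of the periodic estimate to `L²` -/

namespace Equation

variable {m : ℕ} {P : Equation m} {d : ℝ}

/-- `∑_α v_α ∂^α 𝕃⁻¹`. -/
def opM (P : Equation m) (u₀ : P.Hl) : L2 m →L[ℂ] L2 m :=
  ∑ α ∈ P.JG, mulOp (P.coeffV u₀ α) ∘L P.opDL α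

/-- `∑_α v_α 𝕂_α^*`. -/
def opMΩ (P : Equation m) (hd : 0 < d) (u₀ : P.Hl) : L2 m →L[ℂ] L2 m :=
  ∑ α ∈ P.JG, mulOp (P.coeffV u₀ α) ∘L (P.opK hd α).adjoint

theorem opDF_eq (u₀ : P.Hl) : P.opDF u₀ = (1 + P.opM u₀) ∘L P.opL := by
  ext1 u
  simp only [opDF, opDG, opM, add_apply, sum_apply, ContinuousLinearMap.comp_apply,
    one_apply_eq_self]

theorem adjoint_opK (hd : 0 < d) (α : Fin m →₀ ℕ) :
    (P.opK hd α).adjoint = ofFourierRep hd (diagOp fun n => P.symbolDL α (freq d n)) := by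
  unfold opK ofFourierRep
  rw [ContinuousLinearMap.adjoint_comp, ContinuousLinearMap.adjoint_comp,
    ContinuousLinearMap.adjoint_adjoint, ContinuousLinearMap.adjoint_adjoint]
  rfl

/-- Taking adjoints preserves the norm and reverses the order in each summand. -/
theorem norm_opMΩ_sub_opM_le (hd : 0 < d) (u₀ : P.Hl) :
    ‖P.opMΩ hd u₀ - P.opM u₀‖ ≤ ∑ α ∈ P.JG,
      ‖(P.opK hd α - (P.opDL α).adjoint) ∘L (mulOp (P.coeffV u₀ α)).adjoint‖ := by
  unfold opMΩ opM
  rw [← Finset.sum_sub_distrib]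
  refine (norm_sum_le _ _).trans_eq (Finset.sum_congr rfl fun α _ => ?_)
  rw [← ContinuousLinearMap.comp_sub, ← LinearIsometryEquiv.norm_map ContinuousLinearMap.adjoint,
    ContinuousLinearMap.adjoint_comp, map_sub, ContinuousLinearMap.adjoint_adjoint]

section Periodic

variable (hbdd : ∀ α ∈ P.JG, ∃ C : ℝ, ∀ ξ, ‖P.symbolDL α ξ‖ ≤ C) (hd : 0 < d)
  {u₀ : P.Hl} (hu₀ : ∀ᵐ x, x ∉ cube m d → P.toL2 u₀ x = 0)
include hbdd

theorem fourier_diffOp_factor {i : ℕ} (hi : i ∈ Finset.Icc 2 P.N) {k : ℕ} (hk : k ∈ P.J i)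
    (p : Fin i) (u : P.Hl) : (𝓕 (diffOp (P.factor i k p) (P.toL2 u)) : L2 m) =ᵐ[volume]
      fun ξ => symbol (P.factor i k p) ξ * (𝓕 (P.toL2 u) : L2 m) ξ := by
  have h := memLp_top_ratio_factor hbdd hi hk p
  rw [P.diffOp_toL2 h, fourierMult_apply, FourierTransform.fourier_fourierInv_eq]
  exact P.mulOp_ratio_fourier_opL h u

theorem diagOp_ratio {Q : MvPolynomial (Fin m) ℂ} (hQ : Q.support ⊆ P.JG) :
    diagOp (fun n => symbol Q (freq d n) / symbol P.lin (freq d n)) =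
      ∑ α ∈ P.JG, Q.coeff α • diagOp fun n => P.symbolDL α (freq d n) := by
  rw [← diagOp_finsetSum]
  · congr 1
    funext n
    exact P.ratio_eq_sum hQ _
  · intro α hα
    obtain ⟨C, hC⟩ := hbdd α hα
    exact ⟨C, fun n => hC _⟩

include hd hu₀

/-- Each `𝔾^q u₀` is supported in the cube and has coefficients `g^q(ñ) (U₀)ₙ`, so the product over
`q ≠ p` becomes the iterated convolution in `perDG`. -/
theorem cofactor_properties {i : ℕ} (hi : i ∈ Finset.Icc 2 P.N) {k : ℕ} (hk : k ∈ P.J i)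
    (p : Fin i) :
    fourierRep hd (mulOp (P.cofactor u₀ i k p)) =
      (((List.finRange i).erase p).map fun q => convOp fun n =>
        symbol (P.factor i k q) (freq d n) * fourierCoeffs d (P.toL2 u₀) n).prod ∧
    ∀ᵐ x, x ∉ cube m d → P.cofactor u₀ i k p x = 0 := by
  -- Since `i ≥ 2`, removing `p` leaves at least one factor, and the cofactor inherits its support.
  have hl : (List.finRange i).erase p ≠ [] := by
    intro h
    have h1 := List.length_erase_of_mem (List.mem_finRange p)
    rw [h, List.length_finRange] at h1
    have := (Finset.mem_Icc.1 hi).1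
    simp at h1
    omega
  have hF := fun q => fourier_diffOp_factor hbdd hi hk q u₀
  obtain ⟨h1, -, h3⟩ := fourierRep_mulOp_list_prod hd
    (fun q => (diffOp (P.factor i k q) (P.toL2 u₀) : EuclideanSpace ℝ (Fin m) → ℂ))
    (memLp_top_diffOp hbdd hi hk u₀)
    (fun q => ae_zero_of_fourier_eq_symbol_mul _ (hF q) hu₀) hl
  have he : P.cofactor u₀ i k p = fun x => (((List.finRange i).erase p).map fun q =>
      diffOp (P.factor i k q) (P.toL2 u₀) x).prod := by
    funext x
    rw [cofactor, Finset.prod_eq_multiset_prod, Finset.erase_val]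
    rfl
  have hc : ∀ q, fourierCoeffs d (diffOp (P.factor i k q) (P.toL2 u₀)) = fun n =>
      symbol (P.factor i k q) (freq d n) * fourierCoeffs d (P.toL2 u₀) n := fun q =>
    funext fun n => fourierCoeffs_of_fourier_eq_symbol_mul _ (hF q) hu₀ n
  simp only [hc] at h1
  rw [he]
  exact ⟨h1, h3⟩

theorem cutoff_comp_mulOp_coeffV (α : Fin m →₀ ℕ) :
    cutoff m d ∘L mulOp (P.coeffV u₀ α) = mulOp (P.coeffV u₀ α) := by
  rw [mulOp_coeffV hbdd]
  simp only [ContinuousLinearMap.comp_finsetSum, ContinuousLinearMap.comp_smul]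
  refine Finset.sum_congr rfl fun i hi => Finset.sum_congr rfl fun k hk =>
    Finset.sum_congr rfl fun p _ => ?_
  congr 1
  ext1 f
  refine cutoff_eq_self ?_
  filter_upwards [coeFn_mulOp (memLp_top_cofactor hbdd hi hk u₀ p) f,
    (cofactor_properties hbdd hd hu₀ hi hk p).2] with x h1 h2 hx
  exact h1.trans (by rw [h2 hx, zero_mul])

theorem cutoff_comp_opMΩ : cutoff m d ∘L P.opMΩ hd u₀ = P.opMΩ hd u₀ := by
  unfold opMΩ
  rw [ContinuousLinearMap.comp_finsetSum]
  refine Finset.sum_congr rfl fun α _ => ?_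
  rw [← ContinuousLinearMap.comp_assoc, cutoff_comp_mulOp_coeffV hbdd hd hu₀]

/-- Both sides sum over the same monomials once the multi-index sum is regrouped. The lemma
`sum_coeffV_eq` is used with `fourierRep` as the linear map `Ψ`. -/
theorem perDG_eq : P.perDG d (fourierCoeffs d (P.toL2 u₀)) =
    fourierRep hd (P.opMΩ hd u₀) ∘L
      ((P.perL d).toContinuousLinearEquiv : P.Xl d →L[ℂ] Ell2 m) := by
  let Ψ : (L2 m →L[ℂ] L2 m) →ₗ[ℂ] (Ell2 m →L[ℂ] Ell2 m) :=
    { toFun := fourierRep hd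
      map_add' := fun S T => by
        simp only [fourierRep, ContinuousLinearMap.comp_add, ContinuousLinearMap.add_comp]
      map_smul' := fun c S => by
        simp only [fourierRep, ContinuousLinearMap.comp_smul, ContinuousLinearMap.smul_comp,
          RingHom.id_apply] }
  have h := sum_coeffV_eq hbdd Ψ (fun α => diagOp fun n => P.symbolDL α (freq d n)) u₀
  have h1 : fourierRep hd (P.opMΩ hd u₀) =
      ∑ α ∈ P.JG, Ψ (mulOp (P.coeffV u₀ α)) ∘L diagOp fun n => P.symbolDL α (freq d n) := by
    change Ψ _ = _
    unfold opMΩ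
    rw [map_sum]
    refine Finset.sum_congr rfl fun α _ => ?_
    rw [adjoint_opK]
    -- The inner `synth^* ∘ synth` cancels, so `𝕂_α^*` contributes exactly its diagonal matrix.
    change (synth hd).adjoint ∘L (mulOp _ ∘L (synth hd ∘L (_ ∘L (synth hd).adjoint))) ∘L synth hd =
      ((synth hd).adjoint ∘L mulOp _ ∘L synth hd) ∘L _
    simp only [ContinuousLinearMap.comp_assoc, adjoint_synth_comp_synth]
    rfl
  rw [h1, h]
  ext1 U
  simp only [perDG, sum_apply, ContinuousLinearMap.comp_apply]
  refine Finset.sum_congr rfl fun i hi => Finset.sum_congr rfl fun k hk =>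
    Finset.sum_congr rfl fun p _ => ?_
  rw [perDiff, diagOp_ratio hbdd (P.support_factor_subset hi hk p),
    ← (cofactor_properties hbdd hd hu₀ hi hk p).1]
  simp only [sum_apply, ContinuousLinearMap.comp_apply]
  rfl

/-- The identities cancel: `1 - (1 + 𝔹)(1 + M_Ω) = -(𝔹 + M_Ω + 𝔹 M_Ω)` is supported on the cube on
both sides, hence is recovered from its matrix without loss. -/
theorem norm_one_sub_comp_le {BΩ : L2 m →L[ℂ] L2 m}
    (hBΩ : BΩ = cutoff m d ∘L BΩ ∘L cutoff m d)
    {B : Ell2 m →L[ℂ] Ell2 m} (hB : B = 1 + fourierRep hd BΩ) {Z₁ : ℝ}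
    (hZ₁ : ‖1 - P.perA d B ∘L P.perDF d (fourierCoeffs d (P.toL2 u₀))‖ ≤ Z₁) :
    ‖1 - (1 + BΩ) ∘L (1 + P.opMΩ hd u₀)‖ ≤ Z₁ := by
  set R := fourierRep hd (P.opMΩ hd u₀) with hR
  have hcM := cutoff_comp_opMΩ hbdd hd hu₀
  have hMc : P.opMΩ hd u₀ ∘L cutoff m d = P.opMΩ hd u₀ := by
    unfold opMΩ
    rw [ContinuousLinearMap.finsetSum_comp]
    refine Finset.sum_congr rfl fun α _ => ?_
    rw [adjoint_opK]
    unfold ofFourierRep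
    simp only [ContinuousLinearMap.comp_assoc, adjoint_synth_comp_cutoff]
  have hcc : cutoff m d ∘L cutoff m d = cutoff m d := by
    ext1 f; exact cutoff_cutoff d f
  have hcB : cutoff m d ∘L BΩ = BΩ := by
    rw [hBΩ, ← ContinuousLinearMap.comp_assoc, hcc]
  have hBc : BΩ ∘L cutoff m d = BΩ := by
    rw [hBΩ]
    simp only [ContinuousLinearMap.comp_assoc, hcc]
  -- Conjugation by the isometry `L` carries the bound from `X^l` to `ℓ²`.
  have h1 : ‖1 - B ∘L (1 + R)‖ ≤ Z₁ := by
    refine le_trans (ContinuousLinearMap.opNorm_le_bound _ (norm_nonneg _) fun V => ?_) hZ₁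
    have h2 := ContinuousLinearMap.le_opNorm
      (1 - P.perA d B ∘L P.perDF d (fourierCoeffs d (P.toL2 u₀))) ((P.perL d).symm V)
    rw [LinearIsometryEquiv.norm_map] at h2
    refine le_of_eq_of_le ?_ h2
    rw [← LinearIsometryEquiv.norm_map (P.perL d)]
    congr 1
    rw [perDF, perDG_eq hbdd hd hu₀]
    simp [perA, hR]
  have h2 : 1 - (1 + BΩ) ∘L (1 + P.opMΩ hd u₀) = ofFourierRep hd (1 - B ∘L (1 + R)) := by
    have h3 : 1 - B ∘L (1 + R) =
        fourierRep hd (-(BΩ + P.opMΩ hd u₀ + BΩ ∘L P.opMΩ hd u₀)) := by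
      have h4 : fourierRep hd (-(BΩ + P.opMΩ hd u₀ + BΩ ∘L P.opMΩ hd u₀)) =
          -(fourierRep hd BΩ + R + fourierRep hd BΩ ∘L R) := by
        rw [hR, ← fourierRep_comp hd BΩ hcM]
        simp only [fourierRep, ContinuousLinearMap.comp_add, ContinuousLinearMap.add_comp,
          ContinuousLinearMap.comp_neg, ContinuousLinearMap.neg_comp]
      rw [h4, hB]
      ext1 V
      simp
      abel
    rw [h3, ofFourierRep_fourierRep]
    have h5 : cutoff m d ∘L (-(BΩ + P.opMΩ hd u₀ + BΩ ∘L P.opMΩ hd u₀)) ∘L cutoff m d =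
        -(BΩ + P.opMΩ hd u₀ + BΩ ∘L P.opMΩ hd u₀) := by
      simp only [ContinuousLinearMap.comp_add, ContinuousLinearMap.add_comp,
          ContinuousLinearMap.comp_neg, ContinuousLinearMap.neg_comp,
          ContinuousLinearMap.comp_assoc, hMc, hBc, hcM, hcB]
      rw [← ContinuousLinearMap.comp_assoc, hcB]
    rw [h5]
    ext1 f
    simp
    abel
  rw [h2]
  exact (norm_ofFourierRep_le hd _).trans h1

theorem norm_one_sub_comp_opM_le {BΩ : L2 m →L[ℂ] L2 m}
    (hBΩ : BΩ = cutoff m d ∘L BΩ ∘L cutoff m d)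
    {B : Ell2 m →L[ℂ] Ell2 m} (hB : B = 1 + fourierRep hd BΩ) {Z₁ Zu : ℝ}
    (hZ₁ : ‖1 - P.perA d B ∘L P.perDF d (fourierCoeffs d (P.toL2 u₀))‖ ≤ Z₁)
    (hZu : max 1 ‖B‖ * ∑ α ∈ P.JG,
      ‖(P.opK hd α - (P.opDL α).adjoint) ∘L (mulOp (P.coeffV u₀ α)).adjoint‖ ≤ Zu) :
    ‖1 - (1 + BΩ) ∘L (1 + P.opM u₀)‖ ≤ Z₁ + Zu ∧ ‖1 + BΩ‖ ≤ max 1 ‖B‖ := by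
  have h1 : ‖1 + BΩ‖ ≤ max 1 ‖B‖ := by
    have h2 : 1 + BΩ = 1 - cutoff m d + ofFourierRep hd B := by
      have h3 : ofFourierRep hd B = cutoff m d + BΩ := by
        have h4 : ofFourierRep hd (1 + fourierRep hd BΩ) =
            synth hd ∘L (synth hd).adjoint + ofFourierRep hd (fourierRep hd BΩ) := by
          unfold ofFourierRep
          rw [ContinuousLinearMap.add_comp, ContinuousLinearMap.comp_add]
          rfl
        rw [hB, h4, ofFourierRep_fourierRep, ← hBΩ, synth_comp_adjoint]
      rw [h3]
      abel
    rw [h2]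
    exact norm_sub_cutoff_add_ofFourierRep_le hd B
  refine ⟨?_, h1⟩
  have h2 : 1 - (1 + BΩ) ∘L (1 + P.opM u₀) =
      (1 - (1 + BΩ) ∘L (1 + P.opMΩ hd u₀)) + (1 + BΩ) ∘L (P.opMΩ hd u₀ - P.opM u₀) := by
    ext1 f
    simp
    abel
  rw [h2]
  refine (norm_add_le _ _).trans (add_le_add (norm_one_sub_comp_le hbdd hd hu₀ hBΩ hB hZ₁) ?_)
  calc _ ≤ ‖1 + BΩ‖ * ‖P.opMΩ hd u₀ - P.opM u₀‖ := ContinuousLinearMap.opNorm_comp_le _ _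
    _ ≤ max 1 ‖B‖ * _ := by
      gcongr
      exact norm_opMΩ_sub_opM_le hd u₀
    _ ≤ Zu := hZu

end Periodic

end Equation

namespace Equation

/-! ### Surjectivity of `𝕃` -/

section Surjective

variable {m : ℕ} {P : Equation m} {d : ℝ}

open Filter Topology

/-- The bounded function `(1 + |l|)⁻¹`. -/
def damp (P : Equation m) (ξ : EuclideanSpace ℝ (Fin m)) : ℂ :=
  ((1 + ‖symbol P.lin ξ‖ : ℝ) : ℂ)⁻¹

/-- The bounded function `l (1 + |l|)⁻¹`. -/
def dampSymbol (P : Equation m) (ξ : EuclideanSpace ℝ (Fin m)) : ℂ :=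
  P.damp ξ * symbol P.lin ξ

theorem one_add_norm_symbol_ne_zero (ξ : EuclideanSpace ℝ (Fin m)) :
    ((1 + ‖symbol P.lin ξ‖ : ℝ) : ℂ) ≠ 0 := by
  have : 0 < 1 + ‖symbol P.lin ξ‖ := by positivity
  exact_mod_cast this.ne'

theorem damp_ne_zero (ξ : EuclideanSpace ℝ (Fin m)) : P.damp ξ ≠ 0 :=
  inv_ne_zero (one_add_norm_symbol_ne_zero ξ)

theorem norm_damp (ξ : EuclideanSpace ℝ (Fin m)) : ‖P.damp ξ‖ = (1 + ‖symbol P.lin ξ‖)⁻¹ := by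
  rw [damp, norm_inv, Complex.norm_real, Real.norm_of_nonneg (by positivity)]

theorem continuous_damp : Continuous P.damp :=
  (Complex.continuous_ofReal.comp (continuous_const.add (continuous_symbol P.lin).norm)).inv₀
    one_add_norm_symbol_ne_zero

theorem memLp_top_damp : MemLp P.damp ∞ volume := by
  refine memLp_top_of_bound continuous_damp.aestronglyMeasurable 1
    (Eventually.of_forall fun ξ => ?_)
  rw [norm_damp]
  exact inv_le_one_of_one_le₀ (by linarith [norm_nonneg (symbol P.lin ξ)])

theorem memLp_top_dampSymbol : MemLp P.dampSymbol ∞ volume := by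
  refine memLp_top_of_bound (continuous_damp.mul (continuous_symbol P.lin)).aestronglyMeasurable 1
    (Eventually.of_forall fun ξ => ?_)
  rw [dampSymbol, norm_mul, norm_damp, inv_mul_le_one₀ (by positivity)]
  linarith

theorem mulOp_dampSymbol_injective : Function.Injective (mulOp P.dampSymbol) := by
  rw [injective_iff_map_eq_zero]
  intro w hw
  rw [Lp.eq_zero_iff_ae_eq_zero] at hw ⊢
  filter_upwards [hw, coeFn_mulOp memLp_top_dampSymbol w] with ξ h1 h2
  rw [h2] at h1
  exact (mul_eq_zero.1 h1).resolve_left (mul_ne_zero (damp_ne_zero ξ) (P.symbol_lin_ne_zero ξ))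

theorem mulOp_dampSymbol_fourier_toL2 (u : P.Hl) :
    mulOp P.dampSymbol (𝓕 (P.toL2 u) : L2 m) = mulOp P.damp (𝓕 (P.opL u) : L2 m) := by
  refine Lp.ext ?_
  filter_upwards [coeFn_mulOp memLp_top_dampSymbol (𝓕 (P.toL2 u) : L2 m),
    coeFn_mulOp memLp_top_damp (𝓕 (P.opL u) : L2 m), P.coeFn_fourier_opL u] with ξ h1 h2 h3
  rw [h1, h2, h3, dampSymbol, mul_assoc]

/-- Dividing `l w = f̂` by `1 + |l|` gives an equation between bounded operators, which survives
`L²` limits although `l` and `1/l` may both be unbounded. -/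
theorem mem_range_opL {f w : L2 m} (h : mulOp P.dampSymbol w = mulOp P.damp (𝓕 f : L2 m)) :
    ∃ u, P.opL u = f := by
  have h1 : (fun ξ => symbol P.lin ξ * w ξ) =ᵐ[volume] (𝓕 f : L2 m) := by
    filter_upwards [coeFn_mulOp memLp_top_dampSymbol w, coeFn_mulOp memLp_top_damp (𝓕 f : L2 m)]
      with ξ h1 h2
    rw [h, h2, dampSymbol, mul_assoc] at h1
    exact (mul_left_cancel₀ (damp_ne_zero ξ) h1).symm
  have h2 : MemLp (fun ξ => symbol P.lin ξ * (𝓕 (𝓕⁻ w : L2 m) : L2 m) ξ) 2 volume := by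
    rw [FourierTransform.fourier_fourierInv_eq]
    exact (Lp.memLp (𝓕 f : L2 m)).ae_eq h1.symm
  let u : P.Hl := (⟨𝓕⁻ w, h2⟩ : P.hlSubmodule)
  have hu : P.toL2 u = 𝓕⁻ w := rfl
  refine ⟨u, ?_⟩
  have h3 : (𝓕 (P.opL u) : L2 m) = 𝓕 f := by
    refine Lp.ext ?_
    filter_upwards [P.coeFn_fourier_opL u, h1] with ξ a b
    rw [a, hu, FourierTransform.fourier_fourierInv_eq, b]
  exact (Lp.fourierTransformₗᵢ (EuclideanSpace ℝ (Fin m)) ℂ).injective h3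

theorem exists_seq_hasCompactSupport_tendsto (f : L2 m) :
    ∃ (g : ℕ → EuclideanSpace ℝ (Fin m) → ℂ) (hg : ∀ n, MemLp (g n) 2 volume),
      (∀ n, Continuous (g n)) ∧ (∀ n, HasCompactSupport (g n)) ∧
      Tendsto (fun n => ((hg n).toLp : L2 m)) atTop (𝓝 f) := by
  have hdense : ∀ n : ℕ, ∃ g : EuclideanSpace ℝ (Fin m) → ℂ, HasCompactSupport g ∧
      eLpNorm ((f : EuclideanSpace ℝ (Fin m) → ℂ) - g) 2 volume ≤
        ENNReal.ofReal (1 / ((n : ℝ) + 1)) ∧ Continuous g ∧ MemLp g 2 volume := fun n =>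
    (Lp.memLp f).exists_hasCompactSupport_eLpNorm_sub_le (by norm_num)
      (by rw [Ne, ENNReal.ofReal_eq_zero, not_le]; positivity)
  choose g hgs hgf hgc hg using hdense
  refine ⟨g, hg, hgc, hgs, ?_⟩
  rw [tendsto_iff_norm_sub_tendsto_zero]
  refine squeeze_zero (fun n => norm_nonneg _) (fun n => ?_) tendsto_one_div_add_atTop_nhds_zero_nat
  rw [norm_sub_rev, Lp.norm_def]
  refine ENNReal.toReal_le_of_le_ofReal (by positivity) (le_trans (le_of_eq ?_) (hgf n))
  refine eLpNorm_congr_ae ?_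
  filter_upwards [Lp.coeFn_sub f (hg n).toLp, (hg n).coeFn_toLp] with x h1 h2
  rw [h1, Pi.sub_apply, Pi.sub_apply, h2]

variable {A : L2 m →L[ℂ] P.Hl} {BΩ : L2 m →L[ℂ] L2 m}
  (hBΩ : BΩ = cutoff m d ∘L BΩ ∘L cutoff m d) (hA : P.opL ∘L A = 1 + BΩ)
include hBΩ hA

/-- `𝔹` annihilates functions vanishing on the cube, so there `𝔸` is a right inverse of `𝕃`. -/
theorem opL_apply_sub_cutoff (f : L2 m) : P.opL (A (f - cutoff m d f)) = f - cutoff m d f := by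
  have h := DFunLike.congr_fun hA (f - cutoff m d f)
  rw [ContinuousLinearMap.comp_apply] at h
  rw [h, hBΩ, add_apply, ContinuousLinearMap.comp_apply, ContinuousLinearMap.comp_apply,
    map_sub (cutoff m d), cutoff_cutoff, sub_self, map_zero, map_zero, add_zero]
  rfl

/-- On functions supported off the cube, `𝕃⁻¹` is bounded in `L²`. -/
theorem exists_bound_toL2 : ∃ C : ℝ, ∀ f : L2 m,
    ‖P.toL2 (A (f - cutoff m d f))‖ ≤ C * ‖f‖ := by
  let T : L2 m →ₗ[ℂ] L2 m := P.toL2 ∘ₗ (A : L2 m →ₗ[ℂ] P.Hl) ∘ₗ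
    ((1 - cutoff m d : L2 m →L[ℂ] L2 m) : L2 m →ₗ[ℂ] L2 m)
  have hT : ∀ f, T f = P.toL2 (A (f - cutoff m d f)) := fun f => rfl
  have hgr : ∀ f, mulOp P.dampSymbol (𝓕 (T f) : L2 m) =
      mulOp P.damp (𝓕 (f - cutoff m d f) : L2 m) := by
    intro f
    rw [hT, mulOp_dampSymbol_fourier_toL2, opL_apply_sub_cutoff hBΩ hA]
  -- Boundedness of `𝔸` is in the norm of `H^l`, which need not control that of `L²`; the closed
  -- graph theorem supplies the bound instead. The graph is closed because `hgr` relates `T f` to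
  -- `f` through bounded operators, one of them injective.
  let T' : L2 m →L[ℂ] L2 m := ContinuousLinearMap.ofSeqClosedGraph (g := T) (by
    intro f x y hf hTf
    have hF : Continuous fun f : L2 m => (𝓕 f : L2 m) :=
      (Lp.fourierTransformₗᵢ (EuclideanSpace ℝ (Fin m)) ℂ).continuous
    have h1 : Tendsto (fun n => mulOp P.dampSymbol (𝓕 (T (f n)) : L2 m)) atTop
        (𝓝 (mulOp P.dampSymbol (𝓕 y : L2 m))) :=
      (((mulOp P.dampSymbol).continuous.comp hF).tendsto y).comp hTf
    have h2 : Tendsto (fun n => mulOp P.damp (𝓕 (f n - cutoff m d (f n)) : L2 m)) atTop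
        (𝓝 (mulOp P.damp (𝓕 (x - cutoff m d x) : L2 m))) :=
      (((mulOp P.damp).continuous.comp (hF.comp
        (continuous_id.sub (cutoff m d).continuous))).tendsto x).comp hf
    simp only [hgr] at h1
    have h3 := tendsto_nhds_unique h1 h2
    rw [← hgr] at h3
    exact (Lp.fourierTransformₗᵢ (EuclideanSpace ℝ (Fin m)) ℂ).injective
      (mulOp_dampSymbol_injective h3))
  exact ⟨‖T'‖, fun f => T'.le_opNorm f⟩

/-- Translate `g` off the cube, solve there with the uniform constant of `exists_bound_toL2`, and
translate back; Fourier multipliers commute with translations. A coordinate to translate along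
exists only for `m ≠ 0`. -/
theorem exists_bound_of_hasCompactSupport (hm : m ≠ 0) :
    ∃ C : ℝ, ∀ (g : EuclideanSpace ℝ (Fin m) → ℂ) (hg : MemLp g 2 volume), Continuous g →
      HasCompactSupport g → ∃ w : L2 m,
        mulOp P.dampSymbol w = mulOp P.damp (𝓕 (hg.toLp : L2 m) : L2 m) ∧
        ‖w‖ ≤ C * ‖(hg.toLp : L2 m)‖ := by
  obtain ⟨C, hC⟩ := exists_bound_toL2 hBΩ hA
  refine ⟨C, fun g hg hgc hgs => ?_⟩
  obtain ⟨R, hR⟩ := hgs.isBounded.subset_closedBall (0 : EuclideanSpace ℝ (Fin m))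
  let j₀ : Fin m := ⟨0, Nat.pos_of_ne_zero hm⟩
  -- For `x` in the cube, `x j₀ < d`, so the `j₀`-th coordinate of `x + v` is below `-R`, outside
  -- the ball containing the support of `g`.
  let v : EuclideanSpace ℝ (Fin m) := EuclideanSpace.single j₀ (-(R + d))
  have hmp := measurePreserving_add_right (volume : Measure (EuclideanSpace ℝ (Fin m))) v
  have hg' : MemLp (fun x => g (x + v)) 2 volume := hg.comp_measurePreserving hmp
  have hcut : cutoff m d (hg'.toLp : L2 m) = 0 := by
    rw [Lp.eq_zero_iff_ae_eq_zero]
    filter_upwards [coeFn_cutoff d (hg'.toLp : L2 m), hg'.coeFn_toLp] with x h1 h2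
    rw [h1]
    by_cases hx : x ∈ cube m d
    · rw [Set.indicator_of_mem hx, h2]
      refine image_eq_zero_of_notMem_tsupport fun hmem => ?_
      have h3 := hR hmem
      rw [mem_closedBall_zero_iff] at h3
      have h4 := PiLp.norm_apply_le (x + v) j₀
      have h5 := (hx j₀).2
      have h6 : (x + v) j₀ = x j₀ - (R + d) := by simp [v]; ring
      rw [h6, Real.norm_eq_abs] at h4
      have := neg_abs_le (x j₀ - (R + d))
      linarith
    · rw [Set.indicator_of_notMem hx]; rfl
  set f' : L2 m := hg'.toLp with hf'
  have hnorm : ‖f'‖ = ‖(hg.toLp : L2 m)‖ := by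
    rw [hf', Lp.norm_toLp, Lp.norm_toLp]
    congr 1
    exact eLpNorm_comp_measurePreserving hg.1 hmp
  have hgi : Integrable g := hgc.integrable_of_hasCompactSupport hgs
  have hgi' : Integrable fun x => g (x + v) := hgi.comp_add_right v
  have e1 := fourier_toLp_ae_eq hg hgi
  have e2 := fourier_toLp_ae_eq hg' hgi'
  have e3 : ∀ ξ, 𝓕 (fun x => g (x + v)) ξ = (Real.fourierChar (inner ℝ v ξ) : ℂ) * 𝓕 g ξ :=
    fun ξ => congrFun (VectorFourier.fourierIntegral_comp_add_right Real.fourierChar volume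
      (innerₗ (EuclideanSpace ℝ (Fin m))) g v) ξ
  -- The phase that undoes the translation on the Fourier side.
  let E : EuclideanSpace ℝ (Fin m) → ℂ := fun ξ => (Real.fourierChar (-inner ℝ v ξ) : ℂ)
  have hE : MemLp E ∞ volume := by
    refine memLp_top_of_bound (Continuous.aestronglyMeasurable (by fun_prop)) 1
      (Eventually.of_forall fun ξ => ?_)
    rw [Circle.norm_coe]
  have hEE : ∀ ξ, E ξ * (Real.fourierChar (inner ℝ v ξ) : ℂ) = 1 := by
    intro ξ
    rw [← Circle.coe_mul, ← AddChar.map_add_eq_mul, neg_add_cancel, AddChar.map_zero_eq_one,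
      Circle.coe_one]
  have hT : P.opL (A f') = f' := by
    have := opL_apply_sub_cutoff hBΩ hA f'
    rwa [hcut, sub_zero] at this
  have hTn : ‖P.toL2 (A f')‖ ≤ C * ‖f'‖ := by
    have := hC f'
    rwa [hcut, sub_zero] at this
  refine ⟨mulOp E (𝓕 (P.toL2 (A f')) : L2 m), ?_, ?_⟩
  · have h1 := mulOp_dampSymbol_fourier_toL2 (A f')
    rw [hT] at h1
    refine Lp.ext ?_
    filter_upwards [coeFn_mulOp memLp_top_dampSymbol (mulOp E (𝓕 (P.toL2 (A f')) : L2 m)),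
      coeFn_mulOp hE (𝓕 (P.toL2 (A f')) : L2 m),
      coeFn_mulOp memLp_top_dampSymbol (𝓕 (P.toL2 (A f')) : L2 m),
      coeFn_mulOp memLp_top_damp (𝓕 f' : L2 m),
      coeFn_mulOp memLp_top_damp (𝓕 (hg.toLp : L2 m) : L2 m), e1, e2] with ξ a1 a2 a3 a4 a5 a6 a7
    rw [h1, a4] at a3
    rw [a1, a2, a5, a6, mul_left_comm, ← a3, a7, e3]
    linear_combination P.damp ξ * 𝓕 g ξ * hEE ξ
  · rw [← hnorm]
    refine le_trans ?_ hTn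
    rw [← Lp.norm_fourier_eq (P.toL2 (A f'))]
    refine Lp.norm_le_norm_of_ae_le ?_
    filter_upwards [coeFn_mulOp hE (𝓕 (P.toL2 (A f')) : L2 m)] with ξ h
    rw [h, norm_mul, Circle.norm_coe, one_mul]

theorem opL_surjective : Function.Surjective P.opL := by
  intro f
  rcases Nat.eq_zero_or_pos m with hm | hm
  -- In dimension zero `ℝᵐ` is a point and `l` a nonzero constant.
  · subst hm
    refine mem_range_opL (w := (symbol P.lin 0)⁻¹ • (𝓕 f : L2 0)) ?_
    refine Lp.ext ?_
    filter_upwards [coeFn_mulOp memLp_top_dampSymbol ((symbol P.lin 0)⁻¹ • (𝓕 f : L2 0)),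
      coeFn_mulOp memLp_top_damp (𝓕 f : L2 0), Lp.coeFn_smul (symbol P.lin 0)⁻¹ (𝓕 f : L2 0)]
      with ξ h1 h2 h3
    rw [h1, h2, h3, Pi.smul_apply, smul_eq_mul, dampSymbol, Subsingleton.elim ξ 0,
      mul_assoc, mul_inv_cancel_left₀ (P.symbol_lin_ne_zero 0)]
  obtain ⟨C, hC⟩ := exists_bound_of_hasCompactSupport hBΩ hA hm.ne'
  obtain ⟨g, hg, hgc, hgs, hG⟩ := exists_seq_hasCompactSupport_tendsto f
  have hw := fun n => hC (g n) (hg n) (hgc n) (hgs n)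
  choose w hw hwn using hw
  -- Solutions are unique, so the bound applied to `g n.1 - g n.2` controls `w n.1 - w n.2` by the
  -- same constant.
  have hcau : CauchySeq w := by
    rw [cauchySeq_iff_tendsto_dist_atTop_0]
    have h0 := cauchySeq_iff_tendsto_dist_atTop_0.1 hG.cauchySeq
    refine squeeze_zero (fun n => dist_nonneg) (fun n => ?_) (by simpa using h0.const_mul C)
    obtain ⟨w', h1, h2⟩ := hC (g n.1 - g n.2) ((hg n.1).sub (hg n.2)) ((hgc n.1).sub (hgc n.2))
      ((hgs n.1).sub (hgs n.2))
    rw [MemLp.toLp_sub (hg n.1) (hg n.2)] at h1 h2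
    have h3 : w' = w n.1 - w n.2 := by
      refine mulOp_dampSymbol_injective (P := P) ?_
      rw [h1, map_sub, hw, hw, ← map_sub]
      congr 1
      exact (Lp.fourierTransformₗᵢ (EuclideanSpace ℝ (Fin m)) ℂ).map_sub _ _
    rw [dist_eq_norm, dist_eq_norm, ← h3]
    exact h2
  obtain ⟨w₀, hw₀⟩ := cauchySeq_tendsto_of_complete hcau
  refine mem_range_opL (w := w₀) ?_
  have hF : Continuous fun f : L2 m => (𝓕 f : L2 m) :=
    (Lp.fourierTransformₗᵢ (EuclideanSpace ℝ (Fin m)) ℂ).continuous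
  have h1 := ((mulOp P.dampSymbol).continuous.tendsto w₀).comp hw₀
  have h2 := (((mulOp P.damp).continuous.comp hF).tendsto f).comp hG
  refine tendsto_nhds_unique h1 (h2.congr fun n => ?_)
  exact (hw n).symm

end Surjective

end Equation

/-! ### Compactness of the linearization -/

section Compact

variable {m : ℕ}

open Filter Topology

theorem norm_sq_eq_integral (f : L2 m) : ‖f‖ ^ 2 = ∫ x, ‖f x‖ ^ 2 := by
  have h : ((‖f‖ : ℝ) : ℂ) ^ 2 = ((∫ x, ‖f x‖ ^ 2 : ℝ) : ℂ) := by
    rw [← integral_complex_ofReal]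
    refine (inner_self_eq_norm_sq_to_K (𝕜 := ℂ) f).symm.trans ?_
    rw [L2.inner_def]
    refine integral_congr_ae (Eventually.of_forall fun x => ?_)
    refine (inner_self_eq_norm_sq_to_K (𝕜 := ℂ) (f x)).trans ?_
    push_cast
    rfl
  exact_mod_cast h

/-- A bounded sequence in `L²` has a weakly convergent subsequence. -/
theorem exists_weakly_convergent_subseq (f : ℕ → L2 m) {R : ℝ} (hf : ∀ n, ‖f n‖ ≤ R) :
    ∃ (g : L2 m) (φ : ℕ → ℕ), ‖g‖ ≤ R ∧ StrictMono φ ∧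
      ∀ h : L2 m, Tendsto (fun n => inner ℂ h (f (φ n))) atTop (𝓝 (inner ℂ h g)) := by
  have hmem : ∀ n, StrongDual.toWeakDual (InnerProductSpace.toDual ℂ (L2 m) (f n)) ∈
      WeakDual.toStrongDual ⁻¹' Metric.closedBall (0 : StrongDual ℂ (L2 m)) R := by
    intro n
    rw [Set.mem_preimage, mem_closedBall_zero_iff]
    change ‖InnerProductSpace.toDual ℂ (L2 m) (f n)‖ ≤ R
    rw [LinearIsometryEquiv.norm_map]
    exact hf n
  have : Fact ((2 : ℝ≥0∞) ≠ ∞) := ⟨by norm_num⟩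
  have : SecondCountableTopology (L2 m) := Lp.SecondCountableTopology
  -- Sequential Banach–Alaoglu in the separable space `L²`, transported by the Riesz isomorphism.
  obtain ⟨ψ, hψ, φ, hφ, ht⟩ := WeakDual.isSeqCompact_closedBall ℂ (L2 m) 0 R hmem
  refine ⟨(InnerProductSpace.toDual ℂ (L2 m)).symm (WeakDual.toStrongDual ψ), φ, ?_, hφ,
    fun h => ?_⟩
  · rw [LinearIsometryEquiv.norm_map]
    simpa using hψ
  · have h1 := ((WeakDual.eval_continuous h).tendsto ψ).comp ht
    have h2 := (Complex.continuous_conj.tendsto _).comp h1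
    have h3 : (starRingEnd ℂ) (ψ h) = inner ℂ h
        ((InnerProductSpace.toDual ℂ (L2 m)).symm (WeakDual.toStrongDual ψ)) := by
      rw [← inner_conj_symm, InnerProductSpace.toDual_symm_apply]
      rfl
    rw [← h3]
    refine h2.congr fun n => ?_
    rw [← inner_conj_symm]
    rfl

/-- A Hilbert–Schmidt argument: along a weakly convergent sequence the values `⟪K x, f n⟫` converge
for each `x`, and `|w|²` times a constant dominates, so the images converge in norm. -/
theorem isCompactOperator_mulOp_comp_fourierMult {w σ : EuclideanSpace ℝ (Fin m) → ℂ}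
    (hw2 : MemLp w 2 volume) (hwi : MemLp w ∞ volume) (h2 : MemLp σ 2 volume)
    (hi : MemLp σ ∞ volume) : IsCompactOperator (mulOp w ∘L fourierMult σ) := by
  obtain ⟨K, C, hC, hK⟩ := exists_kernel_fourierMult h2 hi
  refine (isCompactOperator_iff_image_closedBall_subset_compact
    (mulOp w ∘L fourierMult σ : L2 m →ₗ[ℂ] L2 m) (r := 1) one_pos).2 ⟨_, ?_, subset_rfl⟩
  -- The image of the closed ball is itself compact, since weak limits stay in the ball.
  refine IsSeqCompact.isCompact fun y hy => ?_
  choose f hf hfy using hy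
  obtain ⟨g, φ, hg, hφ, hlim⟩ := exists_weakly_convergent_subseq f
    fun n => mem_closedBall_zero_iff.1 (hf n)
  refine ⟨_, ⟨g, mem_closedBall_zero_iff.2 hg, rfl⟩, φ, hφ, ?_⟩
  rw [tendsto_iff_norm_sub_tendsto_zero]
  have hval : ∀ h : L2 m, ‖(mulOp w ∘L fourierMult σ) h‖ ^ 2 =
      ∫ x, ‖w x‖ ^ 2 * ‖inner ℂ (K x) h‖ ^ 2 := by
    intro h
    rw [norm_sq_eq_integral]
    refine integral_congr_ae ?_
    filter_upwards [coeFn_mulOp hwi (fourierMult σ h), hK h] with x h1 h2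
    rw [ContinuousLinearMap.comp_apply, h1, h2, norm_mul, mul_pow]
  have hsq : Tendsto (fun n => ‖(mulOp w ∘L fourierMult σ) (f (φ n) - g)‖ ^ 2) atTop
      (𝓝 0) := by
    simp_rw [hval]
    have h0 : (0 : ℝ) = ∫ _ : EuclideanSpace ℝ (Fin m), (0 : ℝ) := by simp
    rw [h0]
    refine tendsto_integral_of_dominated_convergence (fun x => ‖w x‖ ^ 2 * (C * 2) ^ 2)
      (fun n => ?_) ?_ (fun n => ?_) ?_
    · have hm1 : AEStronglyMeasurable (fun x => inner ℂ (K x) (f (φ n) - g)) volume :=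
        (Lp.aestronglyMeasurable _).congr (hK (f (φ n) - g))
      exact (hw2.1.norm.pow 2).mul (hm1.norm.pow 2)
    · exact ((memLp_two_iff_integrable_sq_norm hw2.1).1 hw2).mul_const _
    · refine Eventually.of_forall fun x => ?_
      rw [Real.norm_of_nonneg (by positivity)]
      have h1 : ‖f (φ n) - g‖ ≤ 2 := by
        have := norm_sub_le (f (φ n)) g
        have := mem_closedBall_zero_iff.1 (hf (φ n))
        linarith
      have h2 : ‖(inner ℂ (K x) (f (φ n) - g) : ℂ)‖ ≤ C * 2 :=
        (norm_inner_le_norm _ _).trans (mul_le_mul (hC x) h1 (norm_nonneg _)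
          ((norm_nonneg _).trans (hC x)))
      gcongr
    · refine Eventually.of_forall fun x => ?_
      have h1 : Tendsto (fun n => (inner ℂ (K x) (f (φ n) - g) : ℂ)) atTop (𝓝 0) := by
        simp_rw [inner_sub_right]
        simpa using (hlim (K x)).sub_const (inner ℂ (K x) g)
      have h2 := ((h1.norm.pow 2).const_mul (‖w x‖ ^ 2))
      simpa using h2
  have hroot := hsq.sqrt
  simp only [Real.sqrt_sq (norm_nonneg _), Real.sqrt_zero] at hroot
  refine hroot.congr fun n => ?_
  rw [map_sub, Function.comp_apply, ← hfy]
  rfl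

theorem isCompactOperator_finsetSum {ι : Type*} (s : Finset ι) (T : ι → L2 m →L[ℂ] L2 m)
    (hT : ∀ i ∈ s, IsCompactOperator (T i)) : IsCompactOperator (∑ i ∈ s, T i : L2 m →L[ℂ] L2 m) :=
  Finset.sum_induction T (fun S : L2 m →L[ℂ] L2 m => IsCompactOperator S)
    (fun _ _ h1 h2 => h1.add h2) isCompactOperator_zero hT

end Compact

/-! ### Invertibility -/

section Invertible

variable {H : Type*} [NormedAddCommGroup H] [NormedSpace ℂ H] [CompleteSpace H]

/-- Closeness of `S(1 + M)` to `1` makes `1 + M` injective, and compactness upgrades this to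
invertibility. Then `S = (S(1 + M))(1 + M)⁻¹` is a product of units, the first by a Neumann series.
-/
theorem isUnit_of_norm_one_sub_mul_lt_one {S M : H →L[ℂ] H} (hM : IsCompactOperator M)
    (h : ‖1 - S * (1 + M)‖ < 1) : IsUnit S ∧ IsUnit (1 + M) := by
  have hinj : ∀ f, (1 + M) f = 0 → f = 0 := by
    intro f hf
    by_contra hne
    have h1 := (1 - S * (1 + M)).le_opNorm f
    have h2 : (1 - S * (1 + M)) f = f := by
      rw [sub_apply, ContinuousLinearMap.mul_def, ContinuousLinearMap.comp_apply, hf, map_zero, sub_zero]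
      rfl
    rw [h2] at h1
    have h3 : 0 < ‖f‖ := norm_pos_iff.2 hne
    nlinarith
  have hU : IsUnit (1 + M) := by
    -- Fredholm alternative: `-1` is either an eigenvalue of `M`, contradicting injectivity, or in
    -- its resolvent set.
    rcases hM.hasEigenvalue_or_mem_resolventSet (μ := (-1 : ℂ)) (by norm_num) with he | hr
    · exfalso
      obtain ⟨f, hf⟩ := he.exists_hasEigenvector
      refine hf.2 (hinj f ?_)
      have h1 := hf.apply_eq_smul
      rw [add_apply]
      change f + M f = 0
      rw [show M f = (-1 : ℂ) • f from h1]
      simp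
    · rw [spectrum.mem_resolventSet_iff] at hr
      have h1 := hr.neg
      rwa [show -((algebraMap ℂ (H →L[ℂ] H)) (-1) - M) = 1 + M by simp [add_comm]] at h1
  refine ⟨?_, hU⟩
  have h1 : IsUnit (S * (1 + M)) := by
    have := isUnit_one_sub_of_norm_lt_one h
    rwa [sub_sub_cancel] at this
  obtain ⟨V, hV⟩ := hU
  have h2 : S = S * (1 + M) * ↑V⁻¹ := by rw [← hV, mul_assoc, Units.mul_inv, mul_one]
  rw [h2]
  exact h1.mul (Units.isUnit _)

end Invertible

/-! ### Compactness of `∑ v_α ∂^α 𝕃⁻¹` -/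

namespace Equation

variable {m : ℕ} {P : Equation m}

theorem opM_eq_sum (hbdd : ∀ α ∈ P.JG, ∃ C : ℝ, ∀ ξ, ‖P.symbolDL α ξ‖ ≤ C) (u₀ : P.Hl) :
    P.opM u₀ = ∑ i ∈ Finset.Icc 2 P.N, ∑ k ∈ P.J i, ∑ p : Fin i,
      mulOp (P.cofactor u₀ i k p) ∘L fourierMult (P.ratio (P.factor i k p)) := by
  have h := sum_coeffV_eq hbdd LinearMap.id P.opDL u₀
  simp only [LinearMap.id_apply] at h
  refine h.trans (Finset.sum_congr rfl fun i hi => Finset.sum_congr rfl fun k hk =>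
    Finset.sum_congr rfl fun p _ => ?_)
  rw [fourierMult_ratio hbdd (P.support_factor_subset hi hk p)]

theorem isCompactOperator_opM (hbdd : ∀ α ∈ P.JG, ∃ C : ℝ, ∀ ξ, ‖P.symbolDL α ξ‖ ≤ C)
    (u₀ : P.Hl) : IsCompactOperator (P.opM u₀) := by
  rw [opM_eq_sum hbdd]
  refine isCompactOperator_finsetSum _ _ fun i hi => isCompactOperator_finsetSum _ _ fun k hk =>
    isCompactOperator_finsetSum _ _ fun p _ => ?_
  -- As `i ≥ 2`, some factor `q ≠ p` remains and places the cofactor in `L²`, not just in `L^∞`.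
  have : Nontrivial (Fin i) := Fin.nontrivial_iff_two_le.2 (Finset.mem_Icc.1 hi).1
  obtain ⟨q, hq⟩ := exists_ne p
  obtain ⟨C, hC⟩ := exists_essBound_diffOp hbdd hi hk u₀
  exact isCompactOperator_mulOp_comp_fourierMult
    (memLp_two_prod (Finset.mem_erase.2 ⟨hq, Finset.mem_univ q⟩) _ hC)
    (memLp_top_cofactor hbdd hi hk u₀ p) (memLp_two_ratio_factor hbdd hi hk p)
    (memLp_top_ratio_factor hbdd hi hk p)

end Equation

end SemilinearPDE

end

/-! ### Assembly of the theorem -/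

open SemilinearPDE in
theorem mainTheorem5 {m : ℕ} (P : Equation m)
    (hbdd : ∀ α ∈ P.JG, ∃ C : ℝ, ∀ ξ, ‖P.symbolDL α ξ‖ ≤ C)
    {d : ℝ} (hd : 0 < d)
    (u₀ : P.Hl) (hu₀ : ∀ᵐ x, x ∉ cube m d → P.toL2 u₀ x = 0)
    (BΩ : L2 m →L[ℂ] L2 m) (hBΩ : BΩ = cutoff m d ∘L BΩ ∘L cutoff m d)
    (A : L2 m →L[ℂ] P.Hl) (hA : P.opL ∘L A = 1 + BΩ)
    (B : Ell2 m →L[ℂ] Ell2 m) (hB : B = 1 + fourierRep hd BΩ)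
    (Z₁ Zu : ℝ)
    (hZ₁ : ‖1 - P.perA d B ∘L P.perDF d (fourierCoeffs d (P.toL2 u₀))‖ ≤ Z₁)
    (hZu : max 1 ‖B‖ * ∑ α ∈ P.JG,
      ‖(P.opK hd α - (P.opDL α).adjoint) ∘L (mulOp (P.coeffV u₀ α)).adjoint‖ ≤ Zu) :
    HasFDerivAt P.opF (P.opDF u₀) u₀ ∧
    ‖1 - A ∘L P.opDF u₀‖ ≤ Z₁ + Zu ∧
    (Z₁ + Zu < 1 →
      (∃ eA : L2 m ≃L[ℂ] P.Hl, (eA : L2 m →L[ℂ] P.Hl) = A) ∧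
      ∃ eF : P.Hl ≃L[ℂ] L2 m, (eF : P.Hl →L[ℂ] L2 m) = P.opDF u₀ ∧
        ‖(eF.symm : L2 m →L[ℂ] P.Hl)‖ ≤ max 1 ‖B‖ / (1 - (Z₁ + Zu))) := by
  obtain ⟨hZ, hB1⟩ := Equation.norm_one_sub_comp_opM_le hbdd hd hu₀ hBΩ hB hZ₁ hZu
  have hA' : ∀ f, P.opL (A f) = (1 + BΩ) f := fun f => DFunLike.congr_fun hA f
  refine ⟨Equation.hasFDerivAt_opF hbdd u₀, ?_, fun hlt => ?_⟩
  · refine ContinuousLinearMap.opNorm_le_bound _ ((norm_nonneg _).trans hZ) fun u => ?_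
    -- Conjugation by the isometry `𝕃` turns `1 - 𝔸 D𝔽(u₀)` into `1 - (1 + 𝔹)(1 + M)`; surjectivity
    -- is not needed for this bound.
    rw [← P.norm_opL, ← P.norm_opL u]
    refine le_of_eq_of_le ?_ (ContinuousLinearMap.le_of_opNorm_le _ hZ (P.opL u))
    congr 1
    rw [Equation.opDF_eq, sub_apply, map_sub, ContinuousLinearMap.comp_apply, hA']
    rfl
  · obtain ⟨⟨S, hS⟩, ⟨V, hV⟩⟩ := isUnit_of_norm_one_sub_mul_lt_one
      (Equation.isCompactOperator_opM hbdd u₀) (hZ.trans_lt hlt)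
    let eL : P.Hl ≃ₗᵢ[ℂ] L2 m := LinearIsometryEquiv.ofSurjective
      ⟨(P.opL : P.Hl →ₗ[ℂ] L2 m), P.norm_opL⟩ (Equation.opL_surjective hBΩ hA)
    have heL : ∀ u, eL u = P.opL u := fun u => rfl
    have hV' : ∀ f, ContinuousLinearEquiv.ofUnit V f = (1 + P.opM u₀) f :=
      fun f => DFunLike.congr_fun hV f
    have hS' : ∀ f, ContinuousLinearEquiv.ofUnit S f = (1 + BΩ) f :=
      fun f => DFunLike.congr_fun hS f
    refine ⟨⟨(ContinuousLinearEquiv.ofUnit S).trans eL.symm.toContinuousLinearEquiv, ?_⟩,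
      eL.toContinuousLinearEquiv.trans (ContinuousLinearEquiv.ofUnit V), ?_, ?_⟩
    · ext1 f
      change eL.symm (ContinuousLinearEquiv.ofUnit S f) = A f
      rw [hS', LinearIsometryEquiv.symm_apply_eq, heL, hA']
    · ext1 u
      change ContinuousLinearEquiv.ofUnit V (eL u) = _
      rw [hV', heL, Equation.opDF_eq]
      rfl
    · have hpos : 0 < 1 - (Z₁ + Zu) := by linarith
      refine ContinuousLinearMap.opNorm_le_bound _ (by positivity) fun f => ?_
      change ‖eL.symm ((ContinuousLinearEquiv.ofUnit V).symm f)‖ ≤ _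
      rw [LinearIsometryEquiv.norm_map]
      set x := (ContinuousLinearEquiv.ofUnit V).symm f with hx
      have hxf : (1 + P.opM u₀) x = f := by
        rw [← hV', hx, ContinuousLinearEquiv.apply_symm_apply]
      -- With `f = (1 + M)x`, the left side is the norm of `(1 - (1 + 𝔹)(1 + M))x`; solving for
      -- `‖x‖` gives the constant.
      have h1 : ‖x - (1 + BΩ) f‖ ≤ (Z₁ + Zu) * ‖x‖ := by
        have := ContinuousLinearMap.le_of_opNorm_le _ hZ x
        rwa [sub_apply, ContinuousLinearMap.comp_apply, hxf] at this
      have h2 : ‖(1 + BΩ) f‖ ≤ max 1 ‖B‖ * ‖f‖ := ContinuousLinearMap.le_of_opNorm_le _ hB1 f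
      have h3 := norm_sub_norm_le x ((1 + BΩ) f)
      rw [div_mul_eq_mul_div, le_div_iff₀ hpos]
      linarith
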